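/- For a finite group $G$, the power graph $\mathcal P(G)$ is the simple graph with vertex set $G$ in which two distinct elements $x,y$ are adjacent if and only if $\langle x\rangle\subseteq\langle y\rangle$ or $\langle y\rangle\subseteq\langle x\rangle$, and $\kappa(G)$ denotes the number of spanning trees of $\mathcal P(G)$. Let $L_m(q)$ denote the projective special linear group $\mathrm{PSL}_m(\mathbb F_q)$, let $\mathbb Z_m$ be the cyclic group of order $m$, and let $A_m$ be the alternating group of degree $m$. Let $q=p^n$ with $p$ prime, $n\geq 1$ and $(p,n)\notin\{(2,1),(3,1)\}$, and let $k=\gcd(q-1,2)$. Then $$\kappa(L_2(q))=p^{\frac{(q^2-1)(p-2)}{p-1}}\cdot\kappa\left(\mathbb Z_{(q-1)/k}\right)^{q(q+1)/2}\cdot\kappa\left(\mathbb Z_{(q+1)/k}\right)^{q(q-1)/2}.$$ In particular: (1) $A_5\cong L_2(5)\cong L_2(4)$ and $\kappa(A_5)=3^{10}\cdot 5^{18}$; (2) $L_3(2)\cong L_2(7)$ and $\kappa(L_3(2))=2^{84}\cdot 3^{28}\cdot 7^{40}$; (3) $A_6\cong L_2(9)$ and $\kappa(A_6)=2^{180}\cdot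 3^{40}\cdot 5^{108}$. -/

import Mathlib

open scoped MatrixGroups

/-- The power graph of a group `G`: the vertices are the elements of `G`, and two distinct elements
are joined when the cyclic subgroup generated by one is contained in that generated by the other. -/
def powerGraph (G : Type*) [Group G] : SimpleGraph G where
  Adj x y := x ≠ y ∧
    (Subgroup.zpowers x ≤ Subgroup.zpowers y ∨ Subgroup.zpowers y ≤ Subgroup.zpowers x)
  symm := ⟨fun _ _ h => ⟨h.1.symm, h.2.symm⟩⟩
  loopless := ⟨fun _ h => h.1 rfl⟩

/-- The complexity of a graph on a finite vertex type: the number of its spanning trees, a spanning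
tree being a subgraph that contains all the vertices and is a tree. (A subgraph containing all the
vertices is the same thing as a graph `T ≤ Γ` on the same vertex type.) -/
noncomputable def graphComplexity {V : Type*} (Γ : SimpleGraph V) : ℕ :=
  Nat.card {T : SimpleGraph V // T ≤ Γ ∧ T.IsTree}

/-- `κ(G)`: the number of spanning trees of the power graph of a finite group `G`. -/
noncomputable def kappa (G : Type*) [Group G] : ℕ := graphComplexity (powerGraph G)

/-- `κ(ℤ_m)`, for the cyclic group of order `m ≥ 1`. -/
noncomputable def kappaCyclic (m : ℕ) : ℕ := kappa (Multiplicative (ZMod m))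

/-! Orienting the edges of a spanning tree towards a vertex `e` turns it into a parent map: each
other vertex chooses a neighbour, and iterating the choices leads to `e`
(`graphComplexity_eq_card_parentMap`). Root the power graph at the identity. If subgroups cover the
group and meet pairwise trivially, a neighbour of `x ≠ 1` stays in the member containing `x`; a
parent map is then an independent choice of one parent map in each member, and `kappa` is
multiplicative (`kappa_eq_prod`).

In `PSL(2, F)` the members are cyclic. Lift `g ≠ 1` to a noncentral matrix `A`; its centralizer in
`SL(2, F)` is the group of norm one units of the quadratic algebra `F[A]` (`range_torusHom`). It is
cyclic of order `q - 1` or `q + 1` when the characteristic polynomial has two distinct roots or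
none, and its image modulo the centre, of order `k`, is the member containing `g`. With a double
root, the centralizer maps to elements of order dividing `p`, and the member has order `p`
(`isCell_of_trace_sq_eq_four`). Counting matrices by trace (`card_trace_eq`) yields `q (q + 1) / 2`,
`q (q - 1) / 2` and `(q ^ 2 - 1) / (p - 1)` members of the three kinds. Groups of order `p` have
complete power graphs, so Cayley's formula supplies the factor `p ^ (p - 2)`; this gives `kappa_eq`.

For the exceptional isomorphisms, the points of the projective line are labelled by binary relations
on a set acted on by `H`, so that generators of `SL(2, F)` and suitable elements of `H` permute the
labels alike. The compatible pairs form a subgroup of `SL(2, F) × H`, which by comparison of orders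
is the graph of a surjection with kernel the centre (`nonempty_PSL_two_mulEquiv`). -/

/-! ### Weighted enumeration of rooted forests. -/

/-- The vertices whose iterated parents lead to a root, where `f i` is the parent of `j i` and the
roots are the vertices outside the range of `j`. -/
inductive ReachesRoot {ι V : Type*} (j f : ι → V) : V → Prop
  | root {v : V} : v ∉ Set.range j → ReachesRoot j f v
  | step (i : ι) : ReachesRoot j f (f i) → ReachesRoot j f (j i)

/-- The parent map `f` defines a rooted forest: every vertex leads to a root. -/
def IsForestMap {ι V : Type*} (j f : ι → V) : Prop := ∀ v, ReachesRoot j f v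

namespace ReachesRoot

/-- Contraction of the edge from `j none` to its parent: the vertices pointing to `j none` are
redirected to `f none`, and `j none` remains as a root without children. Apart from the loop `f none
= j none`, this neither creates nor destroys cycles. It is the induction step of `sum_reachesRoot`.
-/
theorem isForestMap_option_iff {ι V : Type*} [DecidableEq V] {j : Option ι → V}
    (hj : Function.Injective j) (f : Option ι → V) :
    IsForestMap j f ↔ f none ≠ j none ∧ IsForestMap (fun i => j (some i))
        (fun i => if f (some i) = j none then f none else f (some i)) := by
  have hsome : ∀ i, j (some i) ≠ j none := fun i h => by simpa using hj h
  constructor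
  · intro h
    have hne : f none ≠ j none := by
      intro he
      have key : ∀ v, ReachesRoot j f v → v ≠ j none := by
        intro v hv
        induction hv with
        | root hv => rintro rfl; exact hv ⟨_, rfl⟩
        | step i _ ih =>
          cases i with
          | none => exact absurd he ih
          | some i => exact hsome i
      exact key _ (h _) rfl
    refine ⟨hne, ?_⟩
    have key : ∀ v, ReachesRoot j f v → ReachesRoot (fun i => j (some i))
        (fun i => if f (some i) = j none then f none else f (some i))
        (if v = j none then f none else v) := by
      intro v hv
      induction hv with
      | @root v hv =>
        have hv' : v ≠ j none := by rintro rfl; exact hv ⟨_, rfl⟩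
        rw [if_neg hv']
        exact .root (by rintro ⟨i, rfl⟩; exact hv ⟨_, rfl⟩)
      | step i _ ih =>
        cases i with
        | none => simpa [hne] using ih
        | some i =>
          rw [if_neg (hsome i)]
          exact .step (j := fun i => j (some i)) i ih
    intro v
    by_cases hv : v = j none
    · subst hv
      exact .root (by rintro ⟨i, hi⟩; exact hsome i hi)
    · simpa [hv] using key v (h v)
  · rintro ⟨hne, h⟩
    have key : ∀ v, ReachesRoot (fun i => j (some i))
        (fun i => if f (some i) = j none then f none else f (some i)) v → v ≠ j none →
        ReachesRoot j f v := by
      intro v hv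
      induction hv with
      | root hv =>
        intro hv'
        refine .root ?_
        rintro ⟨i, rfl⟩
        cases i with
        | none => exact hv' rfl
        | some i => exact hv ⟨i, rfl⟩
      | step i _ ih =>
        intro _
        refine .step (some i) ?_
        by_cases hi : f (some i) = j none
        · simp only [hi, if_true] at ih
          rw [hi]
          exact .step none (ih hne)
        · simp only [hi, if_false] at ih
          exact ih hi
    intro v
    by_cases hv : v = j none
    · subst hv
      exact .step none (key _ (h _) hne)
    · exact key v (h v) hv

end ReachesRoot

open scoped Classical in
/-- Summing over the fibres of composition with `c`. -/
theorem sum_comp_mul_prod {ι V : Type*} [Fintype ι] [Fintype V] (c : V → V) (w : V → ℕ)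
    (Φ : (ι → V) → ℕ) :
    ∑ h : ι → V, Φ (c ∘ h) * ∏ i, w (h i) =
      ∑ h : ι → V, Φ h * ∏ i, ∑ x with c x = h i, w x := by
  simp_rw [Finset.prod_univ_sum, Finset.mul_sum]
  rw [← Finset.sum_fiberwise Finset.univ (fun h : ι → V => c ∘ h)]
  refine Finset.sum_congr rfl fun h' _ => ?_
  refine Finset.sum_congr ?_ ?_
  · ext h
    simp [funext_iff, Fintype.mem_piFinset]
  · intro h hh
    have : c ∘ h = h' := by
      ext i
      simpa using (Fintype.mem_piFinset.1 hh) i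
    rw [this]

open scoped Classical in
/-- The weighted enumeration of rooted forests: the maps assigning a parent to each vertex in the
range of `j`, such that every vertex leads to a root. -/
theorem sum_reachesRoot (V : Type*) [Fintype V] (ι : Type*) [Fintype ι] :
    ∀ (j : ι → V), Function.Injective j → ∀ w : V → ℕ,
    (∑ v, w v) * ∑ f : ι → V, (if IsForestMap j f then 1 else 0) * ∏ i, w (f i) =
      (∑ v with v ∉ Set.range j, w v) * (∑ v, w v) ^ Fintype.card ι := by
  -- The factor `∑ v, w v` on the left replaces the exponent `card ι - 1` by `card ι`, so the empty
  -- family is no exception. Arbitrary weights are needed because contraction merges the weights of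
  -- two vertices.
  refine Fintype.induction_empty_option (P := fun ι _ => ∀ (j : ι → V), Function.Injective j →
    ∀ w : V → ℕ, (∑ v, w v) * ∑ f : ι → V,
        (if IsForestMap j f then 1 else 0) * ∏ i, w (f i) =
      (∑ v with v ∉ Set.range j, w v) * (∑ v, w v) ^ Fintype.card ι) ?_ ?_ ?_ ι
  · intro α β _ e
    let : Fintype α := Fintype.ofEquiv β e.symm
    intro ih j hj w
    have := ih (j ∘ e) (hj.comp e.injective) w
    simp only [Fintype.card_congr e, Set.range_comp, e.surjective.range_eq, Set.image_univ] at this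
    rw [← this]
    congr 1
    refine (Fintype.sum_equiv (e.arrowCongr (Equiv.refl V)) _ _ fun f => ?_).symm
    have h1 : IsForestMap (j ∘ e) f ↔ IsForestMap j (e.arrowCongr (Equiv.refl V) f) := by
      refine forall_congr' fun v => ?_
      constructor
      · intro h
        induction h with
        | root h => exact .root (by simpa [Set.range_comp] using h)
        | step i _ ih =>
          refine .step (e i) ?_
          simpa using ih
      · intro h
        induction h with
        | root h => exact .root (by simpa [Set.range_comp] using h)
        | step i _ ih =>
          have := ReachesRoot.step (j := j ∘ e) (f := f) (e.symm i) ih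
          simpa using this
    simp only [h1]
    congr 1
    exact Fintype.prod_equiv e _ _ fun i => by simp
  · intro j _ w
    have : ∀ f : PEmpty → V, IsForestMap j f := fun f v => .root (by simp)
    simp [this]
  · intro ι _ ih j hj w
    have hj' : Function.Injective fun i => j (some i) :=
      hj.comp (Option.some_injective _)
    set W := ∑ v, w v with hW
    set m := j none with hm
    have hsome : ∀ i, j (some i) ≠ m := fun i h => by simpa using hj h
    -- Contraction of `m` into its parent `y`, with the weight of `m` moved to `y`.
    set c : V → V → V := fun y x => if x = m then y else x with hc
    have step1 : ∑ f : Option ι → V,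
        (if IsForestMap j f then 1 else 0) * ∏ i, w (f i) =
        ∑ y : V, (if y ≠ m then w y else 0) * ∑ h : ι → V,
          (if IsForestMap (fun i => j (some i)) h then 1 else 0) *
            ∏ i, ∑ x with c y x = h i, w x := by
      rw [← (Equiv.piOptionEquivProd (β := fun _ => V)).symm.sum_comp, Fintype.sum_prod_type]
      refine Finset.sum_congr rfl fun y _ => ?_
      rw [← sum_comp_mul_prod (c y) w
        (fun h => if IsForestMap (fun i => j (some i)) h then 1 else 0), Finset.mul_sum]
      refine Finset.sum_congr rfl fun h _ => ?_
      simp only [ReachesRoot.isForestMap_option_iff hj, Fintype.prod_option]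
      simp only [Equiv.piOptionEquivProd_symm_apply, Function.comp_def, hc]
      by_cases hy : y = m
      · simp [hy, hm]
      · simp only [← hm, ne_eq, hy, not_false_eq_true, true_and, if_true]
        ring
    have tot : ∀ y, ∑ z, ∑ x with c y x = z, w x = W := fun y =>
      Finset.sum_fiberwise Finset.univ (c y) w
    -- After contraction `m` is a root of weight zero, so the weight of the roots grows only if `y`
    -- is a root, and then by `w m`.
    have roots : ∀ y, y ≠ m → ∑ z with z ∉ Set.range (fun i => j (some i)),
        ∑ x with c y x = z, w x = ∑ x with x ∉ Set.range j, w x +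
          if y ∉ Set.range j then w m else 0 := by
      intro y hy
      rw [Finset.sum_sigma']
      have : ∑ x with c y x ∉ Set.range (fun i => j (some i)), w x =
          ∑ x with x ∉ Set.range j, w x + if y ∉ Set.range j then w m else 0 := by
        rw [Finset.sum_filter, Finset.sum_filter, ← Finset.add_sum_erase _ _ (Finset.mem_univ m),
          ← Finset.add_sum_erase Finset.univ (fun x => if x ∉ Set.range j then w x else 0)
            (Finset.mem_univ m)]
        have hyr : y ∈ Set.range (fun i => j (some i)) ↔ y ∈ Set.range j := by
          constructor
          · rintro ⟨i, rfl⟩; exact ⟨_, rfl⟩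
          · rintro ⟨i, rfl⟩
            cases i with
            | none => exact absurd rfl hy
            | some i => exact ⟨i, rfl⟩
        have hmr : m ∈ Set.range j := ⟨none, rfl⟩
        have h2 : ∀ x ∈ Finset.univ.erase m,
            (if c y x ∉ Set.range (fun i => j (some i)) then w x else 0) =
              if x ∉ Set.range j then w x else 0 := by
          intro x hx
          have hx' : x ≠ m := Finset.ne_of_mem_erase hx
          have : x ∈ Set.range (fun i => j (some i)) ↔ x ∈ Set.range j := by
            constructor
            · rintro ⟨i, rfl⟩; exact ⟨_, rfl⟩
            · rintro ⟨i, rfl⟩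
              cases i with
              | none => exact absurd rfl hx'
              | some i => exact ⟨i, rfl⟩
          simp only [hc, hx', if_false, this]
        rw [Finset.sum_congr rfl h2]
        simp only [hc, if_true, hyr, hmr, not_true_eq_false, if_false, zero_add]
        ring
      rw [← this]
      refine Finset.sum_bij' (fun p _ => p.2) (fun x _ => ⟨c y x, x⟩) ?_ ?_ ?_ ?_ ?_
      · rintro ⟨z, x⟩ h
        simp only [Finset.mem_sigma, Finset.mem_filter, Finset.mem_univ, true_and] at h ⊢
        rw [h.2]; exact h.1
      · intro x h
        simpa using h
      · rintro ⟨z, x⟩ h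
        simp only [Finset.mem_sigma, Finset.mem_filter, Finset.mem_univ, true_and] at h
        simp [h.2]
      · intro x _; rfl
      · intro x _; rfl
    refine Eq.trans (congrArg (W * ·) (Eq.trans ?_ step1)) ?_
    · congr!
    rw [Finset.mul_sum]
    have step2 : ∀ y, W * ((if y ≠ m then w y else 0) * ∑ h : ι → V,
          (if IsForestMap (fun i => j (some i)) h then 1 else 0) *
            ∏ i, ∑ x with c y x = h i, w x) =
        (if y ≠ m then w y * (∑ x with x ∉ Set.range j, w x +
          if y ∉ Set.range j then w m else 0) else 0) * W ^ Fintype.card ι := by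
      intro y
      by_cases hy : y = m
      · simp [hy]
      · have := ih _ hj' (fun z => ∑ x with c y x = z, w x)
        rw [tot, roots y hy] at this
        rw [if_pos hy, if_pos hy, mul_left_comm, this, mul_assoc]
    rw [Finset.sum_congr rfl fun y _ => step2 y, ← Finset.sum_mul, Fintype.card_option, pow_succ',
      ← mul_assoc]
    congr 1
    have hmr : m ∈ Set.range j := ⟨none, rfl⟩
    set Rt := ∑ x with x ∉ Set.range j, w x with hRt
    -- Summed over `y`, this is `(W - w m) * Rt + Rt * w m = W * Rt`.
    have e1 : ∀ y, (if y ≠ m then w y * (Rt + if y ∉ Set.range j then w m else 0) else 0) =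
        (if y ≠ m then w y else 0) * Rt + (if y ∉ Set.range j then w y else 0) * w m := by
      intro y
      by_cases hy : y = m
      · simp [hy, hmr]
      · by_cases h2 : y ∈ Set.range j <;> simp only [hy, h2, ne_eq, not_false_eq_true,
          not_true_eq_false, if_true, if_false] <;> ring
    rw [Finset.sum_congr rfl fun y _ => e1 y, Finset.sum_add_distrib, ← Finset.sum_mul,
      ← Finset.sum_mul, ← Finset.sum_filter, ← Finset.sum_filter, ← hRt, mul_comm _ Rt, ← mul_add,
      hW, ← Finset.add_sum_erase Finset.univ w (Finset.mem_univ m), add_comm, Finset.filter_ne']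

/-! ### Spanning trees as parent maps, and Cayley's formula. -/

namespace IsForestMap

variable {V : Type*} {e : V}

/-- A 2-cycle would pass from a vertex to its parent, hence up to a root. Excluding 2-cycles makes
each edge of the tree come from only one of its ends. -/
theorem apply_apply_ne {f : {v : V // v ≠ e} → V} (hf : IsForestMap Subtype.val f)
    (i : {v : V // v ≠ e}) (hi : f i ≠ e) : f ⟨f i, hi⟩ ≠ i := by
  have key : ∀ v, ReachesRoot Subtype.val f v → ∀ (h : v ≠ e) (h' : f ⟨v, h⟩ ≠ e),
      f ⟨f ⟨v, h⟩, h'⟩ ≠ v := by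
    intro v hv
    induction hv with
    | root hv => intro h; simp at hv; exact absurd hv h
    | step i _ ih =>
      intro h h' heq
      refine ih h' (by rw [heq]; exact h) ?_
      congr 1
      exact Subtype.ext heq
  exact key _ (hf i) i.2 hi

/-- The tree whose edges join the vertices to their parents. -/
def tree (f : {v : V // v ≠ e} → V) : SimpleGraph V :=
  SimpleGraph.fromRel fun a b => ∃ h : a ≠ e, f ⟨a, h⟩ = b

theorem tree_adj_apply {f : {v : V // v ≠ e} → V} (hf : ∀ v : {v : V // v ≠ e}, (v : V) ≠ f v)
    (v : {v : V // v ≠ e}) : (tree f).Adj v (f v) :=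
  (SimpleGraph.fromRel_adj _ _ _).2 ⟨hf v, Or.inl ⟨v.2, rfl⟩⟩

theorem connected_tree {f : {v : V // v ≠ e} → V} (hf : IsForestMap Subtype.val f)
    (hf' : ∀ v : {v : V // v ≠ e}, (v : V) ≠ f v) : (tree f).Connected := by
  have key : ∀ v, ReachesRoot Subtype.val f v → (tree f).Reachable v e := by
    intro v hv
    induction hv with
    | @root v hv =>
      obtain rfl : v = e := by simpa using hv
      exact SimpleGraph.Reachable.refl _
    | step i _ ih => exact (tree_adj_apply hf' i).reachable.trans ih
  have : Nonempty V := ⟨e⟩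
  exact ⟨fun u v => (key u (hf u)).trans (key v (hf v)).symm⟩

/-- The tree is connected and has at most one edge for each vertex other than `e`. -/
theorem isTree_tree [Finite V] {f : {v : V // v ≠ e} → V} (hf : IsForestMap Subtype.val f)
    (hf' : ∀ v : {v : V // v ≠ e}, (v : V) ≠ f v) : (tree f).IsTree := by
  have hc := connected_tree hf hf'
  refine SimpleGraph.isTree_iff_connected_and_card.2 ⟨hc, le_antisymm ?_
    hc.card_vert_le_card_edgeSet_add_one⟩
  have hsub : (tree f).edgeSet ⊆ Set.range fun v : {v : V // v ≠ e} => s((v : V), f v) := by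
    intro x hx
    induction x with | h a b =>
    rw [SimpleGraph.mem_edgeSet, tree, SimpleGraph.fromRel_adj] at hx
    rcases hx with ⟨_, ⟨h, rfl⟩ | ⟨h, rfl⟩⟩
    · exact ⟨⟨a, h⟩, rfl⟩
    · exact ⟨⟨b, h⟩, Sym2.eq_swap⟩
  have h1 : Nat.card (tree f).edgeSet ≤ Nat.card {v : V // v ≠ e} :=
    (Nat.card_mono (Set.toFinite _) hsub).trans (Finite.card_range_le _)
  have h2 : Nat.card {v : V // v ≠ e} + 1 = Nat.card V := by
    have := Fintype.ofFinite V
    classical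
    rw [Nat.card_eq_fintype_card, Nat.card_eq_fintype_card, Fintype.card_subtype_compl,
      Fintype.card_subtype_eq]
    have : 0 < Fintype.card V := Fintype.card_pos_iff.2 ⟨e⟩
    omega
  omega

/-- Induction from the root: the edge from `i` to `f i` lies in `tree g`, so either `g i = f i`, or
`g` sends `f i` back to `i`. In the second case `f` does so too by induction, which is a 2-cycle. -/
theorem tree_injective {f g : {v : V // v ≠ e} → V} (hf : IsForestMap Subtype.val f)
    (hf' : ∀ v : {v : V // v ≠ e}, (v : V) ≠ f v) (h : tree f = tree g) : f = g := by
  have key : ∀ v, ReachesRoot Subtype.val f v → ∀ h : v ≠ e, f ⟨v, h⟩ = g ⟨v, h⟩ := by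
    intro v hv
    induction hv with
    | root hv => intro h; simp at hv; exact absurd hv h
    | step i _ ih =>
      intro hi
      have hadj := tree_adj_apply hf' i
      rw [h, tree, SimpleGraph.fromRel_adj] at hadj
      rcases hadj.2 with ⟨_, h1⟩ | ⟨h1, h2⟩
      · exact h1.symm
      · exact absurd ((ih h1).trans h2) (hf.apply_apply_ne i h1)
  exact funext fun v => key v (hf v) v.2

/-- The parent is a neighbour closer to `e`. The resulting connected graph lies in `T`, and a tree
is minimal among connected graphs. -/
theorem exists_tree_eq {T : SimpleGraph V} (hT : T.IsTree) (e : V) :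
    ∃ f : {v : V // v ≠ e} → V, IsForestMap Subtype.val f ∧
      (∀ v : {v : V // v ≠ e}, T.Adj v (f v)) ∧ tree f = T := by
  have hex : ∀ v : {v : V // v ≠ e}, ∃ w, T.Adj v w ∧ T.dist w e < T.dist v e := by
    rintro ⟨v, hv⟩
    obtain ⟨p, hp⟩ := hT.connected.exists_walk_length_eq_dist v e
    cases p with
    | nil => exact absurd rfl hv
    | @cons _ w _ h p =>
      refine ⟨w, h, ?_⟩
      have := SimpleGraph.dist_le p
      simp only [SimpleGraph.Walk.length_cons] at hp
      simp only
      omega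
  choose f hadj hdist using hex
  have hf : IsForestMap Subtype.val f := by
    have key : ∀ n v, T.dist v e = n → ReachesRoot Subtype.val f v := by
      intro n
      induction n using Nat.strong_induction_on with
      | _ n ih =>
        intro v hv
        by_cases h : v = e
        · subst h
          exact .root (by simp)
        · exact .step ⟨v, h⟩ (ih _ (hv ▸ hdist ⟨v, h⟩) _ rfl)
    exact fun v => key _ v rfl
  refine ⟨f, hf, hadj, ?_⟩
  have hle : tree f ≤ T := by
    intro a b hab
    rw [tree, SimpleGraph.fromRel_adj] at hab
    rcases hab with ⟨_, ⟨h, rfl⟩ | ⟨h, rfl⟩⟩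
    · exact hadj ⟨_, h⟩
    · exact (hadj ⟨_, h⟩).symm
  exact le_antisymm hle ((SimpleGraph.isTree_iff_minimal_connected.1 hT).2
    (connected_tree hf fun v => (hadj v).ne) hle)

end IsForestMap

/-- The ways of choosing a neighbour of each vertex other than `e`, so that following the choices
leads to `e`. -/
def ParentMap {V : Type*} (Γ : SimpleGraph V) (e : V) : Type _ :=
  {f : {v : V // v ≠ e} → V // (∀ v : {v : V // v ≠ e}, Γ.Adj v (f v)) ∧ IsForestMap Subtype.val f}

theorem graphComplexity_eq_card_parentMap {V : Type*} [Finite V] (Γ : SimpleGraph V) (e : V) :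
    graphComplexity Γ = Nat.card (ParentMap Γ e) := by
  refine (Nat.card_congr (Equiv.ofBijective (fun f : ParentMap Γ e =>
    (⟨IsForestMap.tree f.1, ?_, f.2.2.isTree_tree fun v => (f.2.1 v).ne⟩ :
      {T : SimpleGraph V // T ≤ Γ ∧ T.IsTree})) ⟨?_, ?_⟩)).symm
  · intro a b hab
    rw [IsForestMap.tree, SimpleGraph.fromRel_adj] at hab
    rcases hab with ⟨_, ⟨h, rfl⟩ | ⟨h, rfl⟩⟩
    · exact f.2.1 ⟨_, h⟩
    · exact (f.2.1 ⟨_, h⟩).symm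
  · rintro ⟨f, hf⟩ ⟨g, hg⟩ h
    exact Subtype.ext (hf.2.tree_injective (fun v => (hf.1 v).ne) (congrArg Subtype.val h))
  · rintro ⟨T, hT, hT'⟩
    obtain ⟨f, hf, hadj, rfl⟩ := IsForestMap.exists_tree_eq hT' e
    exact ⟨⟨f, fun v => hT (hadj v), hf⟩, rfl⟩

/-- **Cayley's formula**. -/
theorem graphComplexity_top {V : Type*} [Finite V] (hV : 2 ≤ Nat.card V) :
    graphComplexity (⊤ : SimpleGraph V) = Nat.card V ^ (Nat.card V - 2) := by
  classical
  have := Fintype.ofFinite V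
  have hpos : 0 < Nat.card V := by omega
  obtain ⟨e⟩ : Nonempty V := (Nat.card_pos_iff.1 hpos).1
  rw [graphComplexity_eq_card_parentMap _ e]
  have h1 : Nat.card (ParentMap (⊤ : SimpleGraph V) e) =
      Nat.card {f : {v : V // v ≠ e} → V // IsForestMap Subtype.val f} := by
    refine Nat.card_congr (Equiv.subtypeEquivRight fun f => ⟨fun h => h.2, fun h => ⟨?_, h⟩⟩)
    intro v hv
    -- A loop `f v = v` would in particular be a 2-cycle.
    have := h.apply_apply_ne v (by rw [← hv]; exact v.2)
    have h2 : (⟨f v, by rw [← hv]; exact v.2⟩ : {v : V // v ≠ e}) = v := Subtype.ext hv.symm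
    rw [h2] at this
    exact this hv.symm
  have h2 := sum_reachesRoot V {v : V // v ≠ e} Subtype.val Subtype.val_injective fun _ => 1
  have h3 : Fintype.card {v : V // v ≠ e} = Nat.card V - 1 := by
    rw [Nat.card_eq_fintype_card, Fintype.card_subtype_compl, Fintype.card_subtype_eq]
  have h4 : ({v ∈ Finset.univ | v ∉ Set.range (Subtype.val : {v : V // v ≠ e} → V)} : Finset V) =
      {e} := by
    ext v; simp
  simp only [Finset.prod_const_one, mul_one, h3] at h2
  rw [Finset.sum_congr h4 fun _ _ => rfl] at h2
  simp only [Finset.sum_const, Finset.card_univ, smul_eq_mul, mul_one, Finset.card_singleton,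
    one_mul, ← Nat.card_eq_fintype_card] at h2
  rw [h1, Nat.card_eq_fintype_card, Fintype.card_subtype, Finset.card_filter]
  refine Nat.eq_of_mul_eq_mul_left hpos ?_
  rw [← pow_succ', show Nat.card V - 2 + 1 = Nat.card V - 1 by omega, ← h2]
  congr!

/-! ### Power graphs and partitions into subgroups. -/

theorem powerGraph_adj {G : Type*} [Group G] {x y : G} : (powerGraph G).Adj x y ↔
    x ≠ y ∧ (x ∈ Subgroup.zpowers y ∨ y ∈ Subgroup.zpowers x) := by
  simp [powerGraph]

theorem graphComplexity_congr {V W : Type*} {Γ : SimpleGraph V} {Δ : SimpleGraph W} (φ : Γ ≃g Δ) :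
    graphComplexity Γ = graphComplexity Δ := by
  refine Nat.card_congr ((Equiv.simpleGraph φ.toEquiv).subtypeEquiv fun T => ?_)
  refine and_congr ?_ ?_
  · constructor
    · intro h a b hab
      have := h (show T.Adj (φ.symm a) (φ.symm b) from hab)
      simpa using φ.map_adj_iff.2 this
    · intro h a b hab
      have := @h (φ a) (φ b) (by
        change T.Adj (φ.toEquiv.symm (φ.toEquiv a)) (φ.toEquiv.symm (φ.toEquiv b))
        rwa [Equiv.symm_apply_apply, Equiv.symm_apply_apply])
      exact φ.map_adj_iff.1 this
  · refine SimpleGraph.Iso.isTree_iff ⟨φ.toEquiv, ?_⟩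
    intro a b
    change T.Adj (φ.toEquiv.symm (φ.toEquiv a)) (φ.toEquiv.symm (φ.toEquiv b)) ↔ _
    rw [Equiv.symm_apply_apply, Equiv.symm_apply_apply]

theorem kappa_congr {G H : Type*} [Group G] [Group H] (φ : G ≃* H) : kappa G = kappa H := by
  refine graphComplexity_congr ⟨φ.toEquiv, ?_⟩
  intro a b
  have key : ∀ x y : G, φ x ∈ Subgroup.zpowers (φ y) ↔ x ∈ Subgroup.zpowers y := by
    intro x y
    simp only [Subgroup.mem_zpowers_iff, ← map_zpow, EmbeddingLike.apply_eq_iff_eq]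
  simp [powerGraph_adj, key]

theorem kappa_eq_kappaCyclic {G : Type*} [Group G] [IsCyclic G] :
    kappa G = kappaCyclic (Nat.card G) :=
  kappa_congr (zmodCyclicMulEquiv ‹_›).symm

/-- The complexity of the power graph is multiplicative over partitions into subgroups. -/
theorem kappa_eq_prod {G : Type*} [Group G] [Finite G] (𝒞 : Finset (Subgroup G))
    (h𝒞 : ∀ g : G, g ≠ 1 → ∃! C, C ∈ 𝒞 ∧ g ∈ C) : kappa G = ∏ C ∈ 𝒞, kappa C := by
  classical
  -- Either `y` is a power of `x`, or `x` is a power of `y` and the member containing `y` must be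
  -- `C`.
  have hmem : ∀ C ∈ 𝒞, ∀ x y : G, x ∈ C → x ≠ 1 → (powerGraph G).Adj x y → y ∈ C := by
    intro C hC x y hx hx1 hxy
    rcases (powerGraph_adj.1 hxy).2 with h | h
    · by_cases hy : y = 1
      · rw [hy]; exact C.one_mem
      · obtain ⟨D, ⟨hD, hyD⟩, -⟩ := h𝒞 y hy
        have hxD : x ∈ D := (Subgroup.zpowers_le.2 hyD) h
        rwa [(h𝒞 x hx1).unique ⟨hC, hx⟩ ⟨hD, hxD⟩]
    · exact (Subgroup.zpowers_le.2 hx) h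
  have hadj : ∀ (C : Subgroup G) (x y : C), (powerGraph G).Adj (x : G) y ↔
      (powerGraph C).Adj x y := by
    intro C x y
    simp only [powerGraph_adj, Subgroup.mem_zpowers_iff, ne_eq, Subtype.ext_iff,
      Subgroup.coe_zpow]
  -- Paths of parents starting in `C` stay in `C`, so reaching the identity can be tested there.
  have hreach : ∀ (C : Subgroup G) (f : {g : G // g ≠ 1} → G) (g : {c : C // c ≠ 1} → C),
      (∀ c, (g c : G) = f ⟨c.1, by simpa using c.2⟩) →
      ∀ c : C, ReachesRoot Subtype.val f (c : G) ↔ ReachesRoot Subtype.val g c := by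
    intro C f g hfg c
    constructor
    · have key : ∀ v : G, ReachesRoot Subtype.val f v → ∀ hv : v ∈ C,
          ReachesRoot Subtype.val g ⟨v, hv⟩ := by
        intro v hv
        induction hv with
        | root h =>
          intro hv
          exact .root (by simpa using h)
        | step i _ ih =>
          intro hv
          have hi : (⟨i, hv⟩ : C) ≠ 1 := by
            intro h; exact i.2 (congrArg Subtype.val h)
          refine .step (j := Subtype.val) (⟨⟨i, hv⟩, hi⟩ : {c : C // c ≠ 1}) ?_
          have h1 : f i ∈ C := by
            have := hfg ⟨⟨i, hv⟩, hi⟩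
            simp only at this
            rw [← this]
            exact (g _).2
          have := ih h1
          convert this using 1
          exact Subtype.ext (hfg _)
      exact fun h => key c h c.2
    · intro h
      induction h with
      | root h => exact .root (by simpa using h)
      | step i _ ih =>
        refine .step (j := Subtype.val) (⟨i.1, by simpa using i.2⟩ : {g : G // g ≠ 1}) ?_
        rw [← hfg]
        exact ih
  unfold kappa
  rw [graphComplexity_eq_card_parentMap _ (1 : G)]
  simp_rw [fun C : Subgroup G => graphComplexity_eq_card_parentMap (powerGraph C) (1 : C)]
  rw [← Finset.prod_coe_sort 𝒞 fun C => Nat.card (ParentMap (powerGraph C) (1 : C)),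
    ← Nat.card_pi]
  let res (f : ParentMap (powerGraph G) 1) (C : 𝒞) (c : {c : C.1 // c ≠ 1}) : C.1 :=
    ⟨f.1 ⟨c.1, by simpa using c.2⟩, hmem C.1 C.2 c.1 _ c.1.2 (by simpa using c.2)
      (f.2.1 ⟨c.1, by simpa using c.2⟩)⟩
  refine Nat.card_congr (Equiv.ofBijective (fun f (C : 𝒞) =>
    (⟨res f C, fun c => (hadj _ _ _).1 (f.2.1 ⟨c.1, by simpa using c.2⟩),
      fun c => (hreach C.1 f.1 (res f C) (fun _ => rfl) c).1 (f.2.2 c)⟩ :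
      ParentMap (powerGraph C.1) 1)) ⟨?_, ?_⟩)
  · intro f g hfg
    refine Subtype.ext (funext fun x => ?_)
    obtain ⟨C, ⟨hC, hx⟩, -⟩ := h𝒞 x x.2
    have h1 := congrArg Subtype.val (congrFun hfg ⟨C, hC⟩)
    exact congrArg Subtype.val (congrFun h1 ⟨⟨x, hx⟩, fun h => x.2 (congrArg Subtype.val h)⟩)
  · intro F
    -- Surjectivity: the parent maps on the members are glued, each `x ≠ 1` using the member that
    -- contains it.
    choose cell hcell hcell' using h𝒞
    have hne : ∀ x : {g : G // g ≠ 1},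
        (⟨x, (hcell x.1 x.2).2⟩ : cell x.1 x.2) ≠ 1 :=
      fun x h => x.2 (congrArg Subtype.val h)
    let f (x : {g : G // g ≠ 1}) : G :=
      ((F ⟨cell x.1 x.2, (hcell x.1 x.2).1⟩).1 ⟨⟨x, (hcell x.1 x.2).2⟩, hne x⟩ : _)
    have hf : ∀ (C : 𝒞) (c : {c : C.1 // c ≠ 1}),
        ((F C).1 c : G) = f ⟨c.1, by simpa using c.2⟩ := by
      rintro ⟨C, hC⟩ ⟨⟨c, hc⟩, hc1⟩
      have hc1' : c ≠ 1 := fun h => hc1 (Subtype.ext h)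
      obtain rfl := hcell' c hc1' C ⟨hC, hc⟩
      rfl
    refine ⟨⟨f, fun x => ?_, fun x => ?_⟩, ?_⟩
    · exact (hadj _ _ _).2 ((F ⟨cell x.1 x.2, (hcell x.1 x.2).1⟩).2.1
        ⟨⟨x, (hcell x.1 x.2).2⟩, hne x⟩)
    · by_cases hx : x = 1
      · exact .root (by simpa using hx)
      · exact (hreach _ f _ (hf ⟨cell x hx, (hcell x hx).1⟩) ⟨x, (hcell x hx).2⟩).2
          ((F ⟨cell x hx, (hcell x hx).1⟩).2.2 _)
    · funext C
      refine Subtype.ext (funext fun c => Subtype.ext ?_)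
      exact (hf C c).symm

theorem kappa_of_prime_card {G : Type*} [Group G] {p : ℕ} (hp : p.Prime) (hG : Nat.card G = p) :
    kappa G = p ^ (p - 2) := by
  have hfin : Finite G := Nat.finite_of_card_ne_zero (hG ▸ hp.ne_zero)
  have : Fact p.Prime := ⟨hp⟩
  have : powerGraph G = ⊤ := by
    ext x y
    rw [powerGraph_adj, SimpleGraph.top_adj, and_iff_left_iff_imp]
    intro _
    by_cases hy : y = 1
    · right; rw [hy]; exact Subgroup.one_mem _
    · left; exact mem_zpowers_of_prime_card hG hy
  rw [kappa, this, graphComplexity_top (hG ▸ hp.two_le), hG]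

theorem kappaCyclic_prime {p : ℕ} (hp : p.Prime) : kappaCyclic p = p ^ (p - 2) :=
  kappa_of_prime_card hp (by rw [Nat.card_congr Multiplicative.toAdd]; exact Nat.card_zmod p)

/-- The subgroups of a cyclic group of order 4 form a chain, so the power graph is complete. -/
theorem kappaCyclic_four : kappaCyclic 4 = 16 := by
  have : powerGraph (Multiplicative (ZMod 4)) = ⊤ := by
    ext x y
    rw [powerGraph_adj, SimpleGraph.top_adj, and_iff_left_iff_imp]
    intro _
    have key : ∀ x y : Multiplicative (ZMod 4), (∃ n : Fin 4, y ^ (n : ℕ) = x) ∨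
      ∃ n : Fin 4, x ^ (n : ℕ) = y := by decide
    rcases key x y with ⟨n, hn⟩ | ⟨n, hn⟩
    · exact Or.inl (hn ▸ Subgroup.npow_mem_zpowers _ _)
    · exact Or.inr (hn ▸ Subgroup.npow_mem_zpowers _ _)
  have hc : Nat.card (Multiplicative (ZMod 4)) = 4 := by
    rw [Nat.card_congr Multiplicative.toAdd]; exact Nat.card_zmod 4
  rw [kappaCyclic, kappa, this, graphComplexity_top] <;> rw [hc] <;> norm_num

/-! ### Centralizers in `SL(2, F)` as norm one groups. -/

namespace Matrix.SpecialLinearGroup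

variable {F : Type*} [Field F]

theorem fin_two_det_eq_one (A : SL(2, F)) : A 0 0 * A 1 1 - A 0 1 * A 1 0 = 1 := by
  rw [← Matrix.det_fin_two]; exact A.det_coe

theorem fin_two_mem_center_iff {A : SL(2, F)} :
    A ∈ Subgroup.center SL(2, F) ↔ A 0 1 = 0 ∧ A 1 0 = 0 ∧ A 0 0 = A 1 1 := by
  rw [mem_center_iff]
  constructor
  · rintro ⟨r, -, hr⟩
    rw [← hr]
    simp
  · rintro ⟨h1, h2, h3⟩
    refine ⟨A 0 0, ?_, ?_⟩
    · have := A.fin_two_det_eq_one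
      rw [h1, ← h3] at this
      simp only [Fintype.card_fin]
      linear_combination this
    · ext i j
      fin_cases i <;> fin_cases j <;> simp [h1, h2, h3]

/-- Commuting means that the triples (upper right entry, lower left entry, difference of the
diagonal entries) of `A` and `B` are proportional; the triple of a noncentral `A` is nonzero. -/
theorem exists_eq_smul_add_smul_of_commute {A B : SL(2, F)} (hA : A ∉ Subgroup.center SL(2, F))
    (h : A * B = B * A) : ∃ x y : F, (B : Matrix (Fin 2) (Fin 2) F) = x • 1 + y • A.1 := by
  have h' : A.1 * B.1 = B.1 * A.1 := congrArg Subtype.val h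
  have h00 := congrFun (congrFun h' 0) 0
  have h01 := congrFun (congrFun h' 0) 1
  have h10 := congrFun (congrFun h' 1) 0
  simp only [Matrix.mul_apply, Fin.sum_univ_two] at h00 h01 h10
  rw [fin_two_mem_center_iff] at hA
  simp only [not_and_or] at hA
  have key : ∃ y : F, B 0 1 = y * A 0 1 ∧ B 1 0 = y * A 1 0 ∧
      B 0 0 - B 1 1 = y * (A 0 0 - A 1 1) := by
    rcases hA with hA | hA | hA
    · refine ⟨B 0 1 / A 0 1, ?_, ?_, ?_⟩ <;> field_simp <;> grind
    · refine ⟨B 1 0 / A 1 0, ?_, ?_, ?_⟩ <;> field_simp <;> grind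
    · have hA' := sub_ne_zero.2 hA
      refine ⟨(B 0 0 - B 1 1) / (A 0 0 - A 1 1), ?_, ?_, ?_⟩ <;> field_simp <;> grind
  obtain ⟨y, h1, h2, h3⟩ := key
  refine ⟨B 0 0 - y * A 0 0, y, ?_⟩
  ext i j
  fin_cases i <;> fin_cases j <;> simp
  · exact h1
  · exact h2
  · linear_combination -h3

theorem mul_self_eq (A : SL(2, F)) :
    A.1 * A.1 = (-1 : F) • (1 : Matrix (Fin 2) (Fin 2) F) + (A 0 0 + A 1 1) • A.1 := by
  have := A.fin_two_det_eq_one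
  ext i j
  fin_cases i <;> fin_cases j <;> simp [Matrix.mul_apply, Fin.sum_univ_two] <;>
    first | ring1 | linear_combination -this

/-- The right side is the norm form of the quadratic algebra: matrices of determinant one in `F[A]`
correspond to norm one units. -/
theorem det_smul_one_add_smul (A : SL(2, F)) (x y : F) :
    (x • (1 : Matrix (Fin 2) (Fin 2) F) + y • A.1).det =
      x * x + (A 0 0 + A 1 1) * x * y - (-1) * y * y := by
  have := A.fin_two_det_eq_one
  rw [Matrix.det_fin_two]
  simp
  linear_combination y ^ 2 * this

/-- The algebra generated by a matrix of determinant one, as the image of an abstract quadratic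
algebra. -/
noncomputable def quadraticAlgHom (A : SL(2, F)) :
    QuadraticAlgebra F (-1) (A 0 0 + A 1 1) →ₐ[F] Matrix (Fin 2) (Fin 2) F :=
  QuadraticAlgebra.lift ⟨A.1, A.mul_self_eq⟩

theorem quadraticAlgHom_apply (A : SL(2, F)) (z) :
    A.quadraticAlgHom z = z.re • (1 : Matrix (Fin 2) (Fin 2) F) + z.im • A.1 := rfl

end Matrix.SpecialLinearGroup

open QuadraticAlgebra in
/-- The units of norm one of the quadratic algebra with `ω ^ 2 = t * ω - 1`. -/
abbrev normOneUnits {F : Type*} [Field F] (t : F) : Subgroup (QuadraticAlgebra F (-1) t)ˣ :=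
  (Units.map (QuadraticAlgebra.norm : QuadraticAlgebra F (-1) t →* F)).ker

theorem mem_normOneUnits {F : Type*} [Field F] {t : F} {z : (QuadraticAlgebra F (-1) t)ˣ} :
    z ∈ normOneUnits t ↔ QuadraticAlgebra.norm z.1 = 1 := by
  rw [MonoidHom.mem_ker, Units.ext_iff]; rfl

namespace Matrix.SpecialLinearGroup

variable {F : Type*} [Field F]

/-- The norm one units of the algebra generated by `A`. -/
noncomputable def torusHom (A : SL(2, F)) : normOneUnits (A 0 0 + A 1 1) →* SL(2, F) where
  toFun z := ⟨A.quadraticAlgHom z.1.1, by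
    rw [quadraticAlgHom_apply, det_smul_one_add_smul]
    exact mem_normOneUnits.1 z.2⟩
  map_one' := Subtype.ext (by simp)
  map_mul' x y := Subtype.ext (map_mul A.quadraticAlgHom x.1.1 y.1.1)

theorem torusHom_coe (A : SL(2, F)) (z : normOneUnits (A 0 0 + A 1 1)) :
    (A.torusHom z).1 = z.1.1.re • (1 : Matrix (Fin 2) (Fin 2) F) + z.1.1.im • A.1 := rfl

theorem torusHom_injective {A : SL(2, F)} (hA : A ∉ Subgroup.center SL(2, F)) :
    Function.Injective A.torusHom := by
  rw [injective_iff_map_eq_one]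
  intro z hz
  have h := congrArg Subtype.val hz
  rw [torusHom_coe] at h
  have h00 := congrFun (congrFun h 0) 0
  have h01 := congrFun (congrFun h 0) 1
  have h10 := congrFun (congrFun h 1) 0
  have h11 := congrFun (congrFun h 1) 1
  simp at h00 h01 h10 h11
  have him : z.1.1.im = 0 := by
    by_contra hne
    refine hA (fin_two_mem_center_iff.2 ⟨h01.resolve_left hne, h10.resolve_left hne, ?_⟩)
    exact mul_left_cancel₀ hne (by linear_combination h00 - h11)
  refine Subtype.ext (Units.ext ?_)
  ext
  · simpa [him, QuadraticAlgebra.re_one] using h00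
  · simpa [QuadraticAlgebra.im_one] using him

theorem range_torusHom {A : SL(2, F)} (hA : A ∉ Subgroup.center SL(2, F)) :
    A.torusHom.range = Subgroup.centralizer {A} := by
  ext B
  rw [Subgroup.mem_centralizer_singleton_iff]
  constructor
  · rintro ⟨z, rfl⟩
    apply Subtype.ext
    simp only [coe_mul, torusHom_coe, mul_add, add_mul, smul_mul_assoc, one_mul, mul_smul_comm,
      mul_one]
  · intro h
    obtain ⟨x, y, hxy⟩ := exists_eq_smul_add_smul_of_commute hA h.symm
    have hnorm : QuadraticAlgebra.norm (⟨x, y⟩ : QuadraticAlgebra F (-1) (A 0 0 + A 1 1)) = 1 := by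
      rw [QuadraticAlgebra.norm_def, ← det_smul_one_add_smul, ← hxy]
      exact B.2
    have hu : IsUnit (⟨x, y⟩ : QuadraticAlgebra F (-1) (A 0 0 + A 1 1)) :=
      QuadraticAlgebra.isUnit_iff_norm_isUnit.2 (by rw [hnorm]; exact isUnit_one)
    exact ⟨⟨hu.unit, mem_normOneUnits.2 hnorm⟩, Subtype.ext hxy.symm⟩

end Matrix.SpecialLinearGroup

section NormOneUnits

variable {F : Type*} [Field F] {t : F}

/-- Evaluation at the distinct roots `a` and `t - a` identifies the algebra with `F × F` and the
norm with the product of the coordinates; the first coordinate then maps the norm one units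
isomorphically onto `Fˣ`. -/
theorem isCyclic_normOneUnits_of_split [Finite F] (ht : t ^ 2 ≠ 4) {a : F} (ha : a * (t - a) = 1) :
    IsCyclic (normOneUnits t) ∧ Nat.card (normOneUnits t) = Nat.card F - 1 := by
  let φ : QuadraticAlgebra F (-1) t →ₐ[F] F :=
    QuadraticAlgebra.lift ⟨a, by simp only [smul_eq_mul]; linear_combination -ha⟩
  have hφ : ∀ z, φ z = z.re + z.im * a := fun z => by
    change z.re • (1 : F) + z.im • a = _
    simp
  have hne : a ≠ t - a := by
    intro h
    apply ht
    have : t = 2 * a := by linear_combination -h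
    rw [← h] at ha
    rw [this]
    linear_combination 4 * ha
  have hn : ∀ z : QuadraticAlgebra F (-1) t, z.norm = φ z * (z.re + z.im * (t - a)) := by
    intro z
    rw [hφ, QuadraticAlgebra.norm_def]
    linear_combination -z.im ^ 2 * ha
  let ψ : normOneUnits t →* Fˣ := (Units.map (φ : _ →* F)).comp (normOneUnits t).subtype
  have hψ : ∀ z, (ψ z : F) = φ z.1.1 := fun z => rfl
  have hbij : Function.Bijective ψ := by
    constructor
    · rw [injective_iff_map_eq_one]
      intro z hz
      have h1 : φ z.1.1 = 1 := by rw [← hψ, hz]; rfl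
      have h2 := mem_normOneUnits.1 z.2
      rw [hn, h1, one_mul] at h2
      rw [hφ] at h1
      have h3 : z.1.1.im = 0 := by
        have : z.1.1.im * (a - (t - a)) = 0 := by linear_combination h1 - h2
        exact (mul_eq_zero.1 this).resolve_right (sub_ne_zero.2 hne)
      refine Subtype.ext (Units.ext ?_)
      ext
      · simpa [h3, QuadraticAlgebra.re_one] using h1
      · simpa [QuadraticAlgebra.im_one] using h3
    · intro u
      have hd := sub_ne_zero.2 hne
      have hu := u.ne_zero
      let z : QuadraticAlgebra F (-1) t :=
        ⟨(u : F) - (u - (u : F)⁻¹) / (a - (t - a)) * a, (u - (u : F)⁻¹) / (a - (t - a))⟩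
      have h1 : φ z = u := by rw [hφ]; simp [z]
      have h2 : z.norm = 1 := by
        rw [hn, h1]
        simp only [z]
        field_simp
        ring
      have hz : IsUnit z := QuadraticAlgebra.isUnit_iff_norm_isUnit.2 (by rw [h2]; exact isUnit_one)
      exact ⟨⟨hz.unit, mem_normOneUnits.2 h2⟩, Units.ext h1⟩
  let e := MulEquiv.ofBijective ψ hbij
  refine ⟨isCyclic_of_surjective e.symm e.symm.surjective, ?_⟩
  rw [Nat.card_congr e.toEquiv, Nat.card_units]

/-- The algebra is the field with `q ^ 2` elements, whose norm maps onto `Fˣ`; the kernel has order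
`(q ^ 2 - 1) / (q - 1)`. -/
theorem isCyclic_normOneUnits_of_nonsplit [Finite F] (ht : ∀ a : F, a * (t - a) ≠ 1) :
    IsCyclic (normOneUnits t) ∧ Nat.card (normOneUnits t) = Nat.card F + 1 := by
  have : Fact (∀ r : F, r ^ 2 ≠ -1 + t * r) := ⟨fun r h => ht r (by linear_combination -h)⟩
  have hfin : Finite (QuadraticAlgebra F (-1) t) :=
    Finite.of_equiv _ (QuadraticAlgebra.equivProd (-1) t).symm
  refine ⟨isCyclic_of_injective_ringHom
    ((Units.coeHom (QuadraticAlgebra F (-1) t)).comp (normOneUnits t).subtype)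
    (Units.val_injective.comp Subtype.val_injective), ?_⟩
  have hnorm : ∀ z : QuadraticAlgebra F (-1) t, Algebra.norm F z = z.norm := by
    intro z
    rw [← QuadraticAlgebra.det_toLinearMap_eq_norm, Algebra.norm_apply]
    rfl
  have hsurj : Function.Surjective
      (Units.map (QuadraticAlgebra.norm : QuadraticAlgebra F (-1) t →* F)) := by
    intro u
    obtain ⟨v, hv⟩ := FiniteField.unitsMap_norm_surjective F (QuadraticAlgebra F (-1) t) u
    refine ⟨v, Units.ext ?_⟩
    rw [← hv]
    simp [hnorm]
  have h1 := Subgroup.card_mul_index (normOneUnits t)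
  rw [Subgroup.index_ker, MonoidHom.range_eq_top.2 hsurj, Subgroup.card_top, Nat.card_units,
    Nat.card_units, Nat.card_congr (QuadraticAlgebra.equivProd (-1) t), Nat.card_prod] at h1
  have hq : 1 < Nat.card F := Finite.one_lt_card
  refine Nat.eq_of_mul_eq_mul_right (Nat.sub_pos_of_lt hq) ?_
  rw [h1]
  obtain ⟨m, hm⟩ := Nat.exists_eq_add_of_lt hq
  rw [hm]
  simp
  have : (1 + m + 1) * (1 + m + 1) = (1 + m + 1 + 1) * (1 + m) + 1 := by ring
  omega

end NormOneUnits

/-! ### Cells: the cyclic members of the partition. -/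

/-- `T` is a cyclic subgroup containing `g`, and all the elements having `g` as a power. -/
structure IsCell {G : Type*} [Group G] (g : G) (T : Subgroup G) : Prop where
  isCyclic : IsCyclic T
  mem : g ∈ T
  mem_of_mem_zpowers : ∀ c, g ∈ Subgroup.zpowers c → c ∈ T

namespace IsCell

variable {G : Type*} [Group G] {g h : G} {S T : Subgroup G}

/-- A generator of a cyclic subgroup containing `g` has `g` as a power, so it lies in the cell of
`g`. This gives `T ≤ S`; then `h ∈ S` gives the converse. -/
theorem eq_of_mem (hT : IsCell h T) (hS : IsCell g S) (hg : g ∈ T) : T = S := by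
  have key : ∀ {x : G} {U V : Subgroup G}, IsCyclic U → IsCell x V → x ∈ U → U ≤ V := by
    intro x U V hU hV hx
    obtain ⟨c, rfl⟩ := (Subgroup.isCyclic_iff_exists_zpowers_eq_top U).1 hU
    exact Subgroup.zpowers_le.2 (hV.mem_of_mem_zpowers c hx)
  have hle := key hT.isCyclic hS hg
  exact le_antisymm hle (key hS.isCyclic hT (hle hT.mem))

theorem unique (hT : IsCell g T) (hS : IsCell g S) : T = S :=
  hT.eq_of_mem hS hT.mem

theorem of_mem (hG : ∀ g : G, g ≠ 1 → ∃ T, IsCell g T) (hT : IsCell h T) (hg : g ∈ T)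
    (hg1 : g ≠ 1) : IsCell g T := by
  obtain ⟨S, hS⟩ := hG g hg1
  rwa [hT.eq_of_mem hS hg]

end IsCell

open Finset in
-- The cells are disjoint outside the identity, so those of order `d` contain `d - 1` nonidentity
-- elements each. The last clause turns counting cells into counting elements.
theorem exists_partition_of_isCell {G : Type*} [Group G] [Finite G]
    (hG : ∀ g : G, g ≠ 1 → ∃ T, IsCell g T) :
    ∃ 𝒞 : Finset (Subgroup G), kappa G = ∏ C ∈ 𝒞, kappaCyclic (Nat.card C) ∧
      (∀ C ∈ 𝒞, ∃ g ≠ 1, IsCell g C) ∧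
      ∀ d, #(𝒞.filter fun C : Subgroup G => Nat.card C = d) * (d - 1) =
        Nat.card {g : G // g ≠ 1 ∧ ∃ T, IsCell g T ∧ Nat.card T = d} := by
  classical
  have := Fintype.ofFinite G
  have := Fintype.ofFinite (Subgroup G)
  let 𝒞 : Finset (Subgroup G) := {C | ∃ g ≠ 1, IsCell g C}
  have hmem : ∀ {C}, C ∈ 𝒞 ↔ ∃ g ≠ 1, IsCell g C := by simp [𝒞]
  refine ⟨𝒞, ?_, fun C hC => hmem.1 hC, ?_⟩
  · rw [kappa_eq_prod 𝒞]
    · refine prod_congr rfl fun C hC => ?_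
      obtain ⟨g, -, hg⟩ := hmem.1 hC
      have := hg.isCyclic
      exact kappa_eq_kappaCyclic
    · intro g hg
      obtain ⟨T, hT⟩ := hG g hg
      refine ⟨T, ⟨hmem.2 ⟨g, hg, hT⟩, hT.mem⟩, ?_⟩
      rintro C ⟨hC, hgC⟩
      obtain ⟨h, hh, hhC⟩ := hmem.1 hC
      exact hhC.eq_of_mem hT hgC
  · intro d
    rw [Nat.card_eq_fintype_card, Fintype.card_subtype]
    have h1 : ({g | g ≠ 1 ∧ ∃ T, IsCell g T ∧ Nat.card T = d} : Finset G) =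
        (𝒞.filter fun C : Subgroup G => Nat.card C = d).biUnion
          fun C => {g | g ∈ C ∧ g ≠ 1} := by
      ext g
      simp only [mem_filter, mem_univ, true_and, mem_biUnion]
      constructor
      · rintro ⟨hg, T, hT, hd⟩
        exact ⟨T, ⟨hmem.2 ⟨g, hg, hT⟩, hd⟩, hT.mem, hg⟩
      · rintro ⟨C, ⟨hC, hd⟩, hgC, hg⟩
        obtain ⟨h, -, hh⟩ := hmem.1 hC
        exact ⟨hg, C, hh.of_mem hG hgC hg, hd⟩
    rw [h1, card_biUnion]
    · rw [sum_const_nat (m := d - 1)]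
      intro C hC
      rw [mem_filter] at hC
      have h2 : ({g | g ∈ C ∧ g ≠ 1} : Finset G) = ({g | g ∈ C} : Finset G).erase 1 := by
        ext g; simp [and_comm]
      rw [h2, card_erase_of_mem (by simp [C.one_mem]), ← hC.2, ← Fintype.card_subtype,
        Nat.card_eq_fintype_card]
    · intro C hC D hD hCD
      rw [Function.onFun, Finset.disjoint_left]
      intro g hgC hgD
      simp only [mem_filter, mem_univ, true_and, coe_filter, Set.mem_ofPred_eq] at hC hD hgC hgD
      obtain ⟨_, -, hx⟩ := hmem.1 hC.1
      obtain ⟨_, -, hy⟩ := hmem.1 hD.1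
      exact hCD (hx.eq_of_mem (hy.of_mem hG hgD.1 hgD.2) hgC.1)

/-! ### Cells of `PSL(2, F)`. -/

namespace Matrix.ProjectiveSpecialLinearGroup

open Matrix.SpecialLinearGroup

variable {F : Type*} [Field F]

theorem commute_of_mem_zpowers {A B : SL(2, F)}
    (h : (A : PSL(2, F)) ∈ Subgroup.zpowers (B : PSL(2, F))) : A * B = B * A := by
  obtain ⟨n, hn⟩ := Subgroup.mem_zpowers_iff.1 h
  rw [← QuotientGroup.mk_zpow, QuotientGroup.eq] at hn
  have h1 := Subgroup.mem_center_iff.1 hn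
  have h2 : A = B ^ n * ((B ^ n)⁻¹ * A) := by group
  have h3 : Commute B ((B ^ n)⁻¹ * A) := h1 B
  have h4 : Commute B A := by
    rw [h2]
    exact (Commute.refl B).zpow_right n |>.mul_right h3
  exact h4.symm

/-- The cell is the image of the centralizer of `A`: anything having `A` as a power modulo the
centre lifts to a matrix commuting with `A`. The centralizer contains the centre, whence the order.
-/
theorem isCell_of_isCyclic {A : SL(2, F)} (hA : A ∉ Subgroup.center SL(2, F))
    (hc : IsCyclic (normOneUnits (A 0 0 + A 1 1))) :
    ∃ T : Subgroup PSL(2, F), IsCell (A : PSL(2, F)) T ∧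
      Nat.card T * Nat.card (Subgroup.center SL(2, F)) =
        Nat.card (normOneUnits (A 0 0 + A 1 1)) := by
  let π := QuotientGroup.mk' (Subgroup.center SL(2, F))
  have hr := range_torusHom hA
  refine ⟨A.torusHom.range.map π, ⟨?_, ?_, ?_⟩, ?_⟩
  · have : IsCyclic A.torusHom.range :=
      isCyclic_of_surjective A.torusHom.rangeRestrict A.torusHom.rangeRestrict_surjective
    exact isCyclic_of_surjective (π.subgroupMap A.torusHom.range)
      (π.subgroupMap_surjective A.torusHom.range)
  · refine ⟨A, ?_, rfl⟩
    rw [hr]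
    exact Subgroup.mem_centralizer_singleton_iff.2 rfl
  · intro c hc
    obtain ⟨C, rfl⟩ := QuotientGroup.mk_surjective c
    refine ⟨C, ?_, rfl⟩
    rw [hr]
    exact Subgroup.mem_centralizer_singleton_iff.2 (commute_of_mem_zpowers hc).symm
  · rw [← Subgroup.relIndex_ker, QuotientGroup.ker_mk']
    have hle : Subgroup.center SL(2, F) ≤ A.torusHom.range := by
      rw [hr]; exact Subgroup.center_le_centralizer _
    rw [← Subgroup.relIndex_bot_left (Subgroup.center SL(2, F)), mul_comm,
      Subgroup.relIndex_mul_relIndex _ _ _ bot_le hle, Subgroup.relIndex_bot_left]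
    exact (Nat.card_congr (MonoidHom.ofInjective (torusHom_injective hA)).toEquiv).symm

/-- Here `A = ε + N` with `N ^ 2 = 0`, so `B` is a scalar plus a multiple of `N`, and its `p`-th
power is a scalar. -/
theorem pow_char_eq_one_of_commute {p : ℕ} (hp : p.Prime) [CharP F p] {A B : SL(2, F)}
    (hA : A ∉ Subgroup.center SL(2, F)) (ht : (A 0 0 + A 1 1) ^ 2 = 4) (h : A * B = B * A) :
    (B : PSL(2, F)) ^ p = 1 := by
  have : Fact p.Prime := ⟨hp⟩
  obtain ⟨x, y, hB⟩ := exists_eq_smul_add_smul_of_commute hA h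
  -- `ε` is the double eigenvalue: half the trace, or 1 in characteristic two, where the trace
  -- vanishes.
  obtain ⟨ε, hε, hε2⟩ : ∃ ε : F, A 0 0 + A 1 1 = 2 * ε ∧ ε ^ 2 = 1 := by
    by_cases h2 : (2 : F) = 0
    · refine ⟨1, ?_, one_pow 2⟩
      have : (4 : F) = 0 := by linear_combination 2 * h2
      rw [this] at ht
      rw [pow_eq_zero_iff two_ne_zero |>.1 ht, h2, zero_mul]
    · refine ⟨(A 0 0 + A 1 1) / 2, by field_simp, ?_⟩
      rw [div_pow, ht]
      have : (4 : F) = 2 ^ 2 := by norm_num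
      rw [this, div_self (pow_ne_zero 2 h2)]
  set N : Matrix (Fin 2) (Fin 2) F := A.1 - ε • 1 with hN
  have hN2 : N ^ 2 = 0 := by
    have h1 := A.mul_self_eq
    rw [hε] at h1
    have h2 : N ^ 2 = A.1 * A.1 - (2 * ε) • A.1 + (ε ^ 2) • 1 := by
      rw [hN, sq, sub_mul, mul_sub, mul_sub]
      simp only [smul_mul_assoc, mul_smul_comm, mul_one, one_mul, smul_smul]
      module
    rw [h2, h1, hε2]
    module
  have hB' : B.1 = (x + y * ε) • (1 : Matrix (Fin 2) (Fin 2) F) + y • N := by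
    rw [hB, hN]
    module
  have hBp : (B ^ p).1 = (x + y * ε) ^ p • (1 : Matrix (Fin 2) (Fin 2) F) := by
    rw [coe_pow, hB', add_pow_char_of_commute, smul_pow, smul_pow, one_pow]
    · rw [pow_eq_zero_of_le hp.two_le hN2, smul_zero, add_zero]
    · exact (Commute.one_left _).smul_left _ |>.smul_right _
  rw [← QuotientGroup.mk_pow, QuotientGroup.eq_one_iff, fin_two_mem_center_iff, hBp]
  simp

theorem mk_ne_one_iff {A : SL(2, F)} :
    (A : PSL(2, F)) ≠ 1 ↔ A ∉ Subgroup.center SL(2, F) :=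
  (QuotientGroup.eq_one_iff A).not

/-- An element having `A` as a power commutes with `A`, so it has order `p` and generates the same
subgroup. -/
theorem isCell_of_trace_sq_eq_four {p : ℕ} (hp : p.Prime) [CharP F p] {A : SL(2, F)}
    (hA : A ∉ Subgroup.center SL(2, F)) (ht : (A 0 0 + A 1 1) ^ 2 = 4) :
    ∃ T : Subgroup PSL(2, F), IsCell (A : PSL(2, F)) T ∧ Nat.card T = p := by
  have : Fact p.Prime := ⟨hp⟩
  have hA1 := mk_ne_one_iff.2 hA
  refine ⟨Subgroup.zpowers (A : PSL(2, F)), ⟨inferInstance, Subgroup.mem_zpowers _, ?_⟩, ?_⟩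
  · intro c hc
    obtain ⟨C, rfl⟩ := QuotientGroup.mk_surjective c
    have hCp := pow_char_eq_one_of_commute hp hA ht (commute_of_mem_zpowers hc)
    have hC1 : (C : PSL(2, F)) ≠ 1 := by
      intro h
      rw [h, Subgroup.zpowers_one_eq_bot, Subgroup.mem_bot] at hc
      exact hA1 hc
    have hcard : Nat.card (Subgroup.zpowers (C : PSL(2, F))) = p := by
      rw [Nat.card_zpowers]; exact orderOf_eq_prime hCp hC1
    have h1 : (⟨A, hc⟩ : Subgroup.zpowers (C : PSL(2, F))) ≠ 1 :=
      fun h => hA1 (congrArg Subtype.val h)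
    have h2 := mem_zpowers_of_prime_card hcard h1
      (g' := ⟨(C : PSL(2, F)), Subgroup.mem_zpowers _⟩)
    obtain ⟨n, hn⟩ := Subgroup.mem_zpowers_iff.1 h2
    exact Subgroup.mem_zpowers_iff.2 ⟨n, congrArg Subtype.val hn⟩
  · rw [Nat.card_zpowers]
    exact orderOf_eq_prime (pow_char_eq_one_of_commute hp hA ht rfl) hA1

end Matrix.ProjectiveSpecialLinearGroup

/-- A matrix of `SL(2, F)` given by its entries. -/
def Matrix.SpecialLinearGroup.finTwoMk {F : Type*} [Field F] (a b c d : F)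
    (h : a * d - b * c = 1) : SL(2, F) :=
  ⟨!![a, b; c, d], by rw [Matrix.det_fin_two_of]; exact h⟩

open Matrix.SpecialLinearGroup

/-! ### Counting matrices by trace. -/

section Count

open Finset

variable {F : Type*} [Field F] [Fintype F] [DecidableEq F]

theorem card_mul_eq_const (s : F) :
    ∑ b : F, #{c : F | b * c = s} = Fintype.card F - 1 + if s = 0 then Fintype.card F else 0 := by
  rw [← Finset.add_sum_erase _ _ (mem_univ (0 : F)), add_comm]
  congr 1
  · rw [sum_const_nat (m := 1), mul_one, card_erase_of_mem (mem_univ _), card_univ]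
    intro b hb
    rw [card_eq_one]
    have hb' := ne_of_mem_erase hb
    refine ⟨b⁻¹ * s, ?_⟩
    ext c
    simp only [mem_filter, mem_univ, true_and, mem_singleton]
    constructor
    · rintro rfl
      field_simp
    · rintro rfl
      field_simp
  · by_cases hs : s = 0
    · simp [hs]
    · simp [hs, Ne.symm hs]

/-- The number of matrices of given trace in `SL(2, F)`, in terms of the number of roots of the
characteristic polynomial. -/
theorem card_trace_eq (t : F) :
    #{A : SL(2, F) | A 0 0 + A 1 1 = t} = Fintype.card F * (Fintype.card F - 1) +
      Fintype.card F * #{a : F | a * (t - a) = 1} := by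
  -- A matrix of trace `t` is a triple with `b * c = a * (t - a) - 1`. Each `a` allows `q - 1` pairs
  -- `(b, c)`, and `q` more when it is a root.
  have h1 : #{A : SL(2, F) | A 0 0 + A 1 1 = t} =
      #((univ : Finset F).sigma fun a => (univ : Finset F).sigma fun b =>
        ({c : F | b * c = a * (t - a) - 1} : Finset F)) := by
    refine card_bij' (fun A _ => ⟨A 0 0, A 0 1, A 1 0⟩)
      (fun x hx => finTwoMk x.1 x.2.1 x.2.2 (t - x.1) ?_) ?_ ?_ ?_ ?_
    · simp only [mem_sigma, mem_univ, true_and, mem_filter] at hx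
      linear_combination -hx
    · intro A hA
      have hA := (mem_filter.1 hA).2
      simp only [mem_sigma, mem_univ, true_and, mem_filter]
      have := A.fin_two_det_eq_one
      rw [← hA]
      linear_combination -this
    · intro x hx
      refine mem_filter.2 ⟨mem_univ _, ?_⟩
      simp [finTwoMk]
    · intro A hA
      have hA := (mem_filter.1 hA).2
      ext i j
      fin_cases i <;> fin_cases j <;> simp [finTwoMk, ← hA]
    · intro x hx
      simp [finTwoMk]
  rw [h1, card_sigma]
  simp_rw [card_sigma, card_mul_eq_const, sum_add_distrib, sub_eq_zero]
  rw [← sum_filter]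
  simp [mul_comm]

theorem card_roots_of_sq_eq_four {t : F} (ht : t ^ 2 = 4) : #{a : F | a * (t - a) = 1} = 1 := by
  rw [card_eq_one]
  by_cases h2 : (2 : F) = 0
  · have h4 : (4 : F) = 0 := by linear_combination 2 * h2
    rw [h4] at ht
    obtain rfl := pow_eq_zero_iff two_ne_zero |>.1 ht
    refine ⟨1, ?_⟩
    ext a
    simp only [mem_filter, mem_univ, true_and, mem_singleton]
    constructor
    · intro h
      have : (a - 1) ^ 2 = 0 := by linear_combination -h - a * h2
      exact sub_eq_zero.1 (pow_eq_zero_iff two_ne_zero |>.1 this)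
    · rintro rfl
      linear_combination -h2
  · refine ⟨t / 2, ?_⟩
    ext a
    simp only [mem_filter, mem_univ, true_and, mem_singleton]
    constructor
    · intro h
      have : (2 * a - t) ^ 2 = 0 := by linear_combination ht - 4 * h
      have := pow_eq_zero_iff two_ne_zero |>.1 this
      field_simp
      linear_combination this
    · rintro rfl
      field_simp
      linear_combination ht

theorem card_roots_of_split {t a : F} (ht : t ^ 2 ≠ 4) (ha : a * (t - a) = 1) :
    #{a : F | a * (t - a) = 1} = 2 := by
  rw [card_eq_two]
  refine ⟨a, t - a, ?_, ?_⟩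
  · intro h
    rw [← h] at ha
    apply ht
    have : t = 2 * a := by linear_combination -h
    rw [this]
    linear_combination 4 * ha
  · ext b
    simp only [mem_filter, mem_univ, true_and, mem_insert, mem_singleton]
    constructor
    · intro hb
      have : (b - a) * (b - (t - a)) = 0 := by linear_combination ha - hb
      rcases mul_eq_zero.1 this with h | h
      · exact Or.inl (sub_eq_zero.1 h)
      · exact Or.inr (sub_eq_zero.1 h)
    · rintro (rfl | rfl)
      · exact ha
      · linear_combination ha

/-- Each nonzero `a` is a root for exactly one trace, `a + a⁻¹`. -/
theorem sum_card_roots : ∑ t : F, #{a : F | a * (t - a) = 1} = Fintype.card F - 1 := by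
  simp_rw [card_filter]
  rw [sum_comm]
  rw [← Finset.add_sum_erase _ _ (mem_univ (0 : F))]
  simp only [zero_mul, zero_ne_one, if_false, sum_const_zero, zero_add]
  rw [sum_const_nat (m := 1), mul_one, card_erase_of_mem (mem_univ _), card_univ]
  intro a ha
  have ha' := ne_of_mem_erase ha
  rw [← card_filter, card_eq_one]
  refine ⟨a + a⁻¹, ?_⟩
  ext t
  simp only [mem_filter, mem_univ, true_and, mem_singleton]
  constructor
  · intro h
    field_simp
    linear_combination h
  · rintro rfl
    field_simp
    ring

theorem card_SL_two : Fintype.card SL(2, F) =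
    Fintype.card F * (Fintype.card F - 1) * (Fintype.card F + 1) := by
  have h := card_eq_sum_card_fiberwise (f := fun A : SL(2, F) => A 0 0 + A 1 1) (s := univ)
    (t := univ) (fun _ _ => mem_univ _)
  rw [card_univ] at h
  rw [h]
  simp_rw [card_trace_eq]
  rw [sum_add_distrib, ← mul_sum univ (fun t : F => #{a : F | a * (t - a) = 1}), sum_card_roots,
    sum_const, card_univ, smul_eq_mul]
  ring

/-- `sum_card_roots` sorted by the number of roots: two for split traces, one when `t ^ 2 = 4`,
otherwise none. -/
theorem two_mul_card_split_traces :
    2 * #{t : F | t ^ 2 ≠ 4 ∧ ∃ a, a * (t - a) = 1} + #{t : F | t ^ 2 = 4} =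
      Fintype.card F - 1 := by
  rw [← sum_card_roots (F := F)]
  have h : ∀ t : F, #{a : F | a * (t - a) = 1} =
      2 * (if t ^ 2 ≠ 4 ∧ ∃ a, a * (t - a) = 1 then 1 else 0) + if t ^ 2 = 4 then 1 else 0 := by
    intro t
    by_cases h1 : t ^ 2 = 4
    · simp [h1, card_roots_of_sq_eq_four h1]
    · by_cases h2 : ∃ a, a * (t - a) = 1
      · obtain ⟨a, ha⟩ := h2
        rw [card_roots_of_split h1 ha, if_pos ⟨h1, a, ha⟩, if_neg h1]
      · rw [if_neg (fun h => h2 h.2), if_neg h1, card_eq_zero, filter_eq_empty_iff]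
        exact fun a _ ha => h2 ⟨a, ha⟩
  simp_rw [h]
  rw [sum_add_distrib, ← mul_sum, ← card_filter, ← card_filter]

theorem card_split :
    #{A : SL(2, F) | (A 0 0 + A 1 1) ^ 2 ≠ 4 ∧ ∃ a, a * (A 0 0 + A 1 1 - a) = 1} =
      #{t : F | t ^ 2 ≠ 4 ∧ ∃ a, a * (t - a) = 1} *
        (Fintype.card F * (Fintype.card F + 1)) := by
  rw [card_eq_sum_card_fiberwise (f := fun A : SL(2, F) => A 0 0 + A 1 1)
    (t := {t : F | t ^ 2 ≠ 4 ∧ ∃ a, a * (t - a) = 1})]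
  · rw [sum_const_nat]
    intro t ht
    rw [mem_filter] at ht
    rw [filter_filter, filter_congr (q := fun A : SL(2, F) => A 0 0 + A 1 1 = t) (fun A _ =>
      ⟨fun h => h.2, fun h => ⟨by rw [h]; exact ht.2, h⟩⟩), card_trace_eq]
    obtain ⟨-, h1, a, ha⟩ := ht
    rw [card_roots_of_split h1 ha, ← mul_add]
    have : 0 < Fintype.card F := Fintype.card_pos
    congr 1
    omega
  · intro A hA
    exact mem_filter.2 ⟨mem_univ _, (mem_filter.1 hA).2⟩

theorem card_trace_sq_eq_four :
    #{A : SL(2, F) | (A 0 0 + A 1 1) ^ 2 = 4} =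
      #{t : F | t ^ 2 = 4} * Fintype.card F ^ 2 := by
  rw [card_eq_sum_card_fiberwise (f := fun A : SL(2, F) => A 0 0 + A 1 1)
    (t := {t : F | t ^ 2 = 4})]
  · rw [sum_const_nat]
    intro t ht
    rw [mem_filter] at ht
    rw [filter_filter, filter_congr (q := fun A : SL(2, F) => A 0 0 + A 1 1 = t) (fun A _ =>
      ⟨fun h => h.2, fun h => ⟨by rw [h]; exact ht.2, h⟩⟩), card_trace_eq,
      card_roots_of_sq_eq_four ht.2, ← mul_add, sq]
    have : 0 < Fintype.card F := Fintype.card_pos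
    congr 1
    omega
  · intro A hA
    exact mem_filter.2 ⟨mem_univ _, (mem_filter.1 hA).2⟩

theorem card_sq_eq_four : #{t : F | t ^ 2 = 4} = Nat.gcd (Fintype.card F - 1) 2 := by
  have hpos : 1 < Fintype.card F := Fintype.one_lt_card
  by_cases h2 : (2 : F) = 0
  · have h4 : (4 : F) = 0 := by linear_combination 2 * h2
    have hq := FiniteField.even_card_of_char_two (F := F)
      (CharP.ringChar_of_prime_eq_zero Nat.prime_two (by exact_mod_cast h2))
    have : Nat.gcd (Fintype.card F - 1) 2 = 1 := by
      exact ((Nat.Prime.coprime_iff_not_dvd Nat.prime_two).2 (by omega)).symm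
    rw [this, card_eq_one]
    exact ⟨0, by ext t; simp [h4]⟩
  · have hq := FiniteField.odd_card_of_char_ne_two (F := F) (by
      intro h
      apply h2
      have := ringChar.Nat.cast_ringChar (R := F)
      rw [h] at this
      exact_mod_cast this)
    have : Nat.gcd (Fintype.card F - 1) 2 = 2 := Nat.gcd_eq_right (by omega)
    rw [this, card_eq_two]
    refine ⟨2, -2, ?_, ?_⟩
    · intro h
      have : (2 : F) * 2 = 0 := by linear_combination h
      exact h2 (mul_self_eq_zero.1 this)
    · ext t
      simp only [mem_filter, mem_univ, true_and, mem_insert, mem_singleton]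
      rw [← sq_eq_sq_iff_eq_or_eq_neg]
      norm_num

end Count

theorem card_center_SL_two {F : Type*} [Field F] [Fintype F] [DecidableEq F] :
    Nat.card (Subgroup.center SL(2, F)) = Nat.gcd (Fintype.card F - 1) 2 := by
  rw [Nat.card_congr (Matrix.SpecialLinearGroup.center_equiv_rootsOfUnity (n := Fin 2)
    (R := F)).toEquiv]
  have := IsCyclic.card_powMonoidHom_ker (G := Fˣ) 2
  rwa [Nat.card_units, Nat.card_eq_fintype_card (α := F)] at this

theorem QuotientGroup.card_subtype_mk {G : Type*} [Group G] (N : Subgroup G) (P : G ⧸ N → Prop) :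
    Nat.card {g : G // P (QuotientGroup.mk g)} = Nat.card N * Nat.card {h : G ⧸ N // P h} := by
  rw [← Nat.card_prod]
  exact Nat.card_congr (QuotientGroup.preimageMkEquivSubgroupProdSet N {h | P h})

/-! ### The general formula. -/

namespace Matrix.ProjectiveSpecialLinearGroup

open Finset Matrix.SpecialLinearGroup

theorem trace_sq_eq_four_of_mem_center {F : Type*} [Field F] {A : SL(2, F)}
    (hA : A ∈ Subgroup.center SL(2, F)) :
    (A 0 0 + A 1 1) ^ 2 = 4 := by
  obtain ⟨h1, h2, h3⟩ := fin_two_mem_center_iff.1 hA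
  have := A.fin_two_det_eq_one
  rw [h1, h3] at this
  rw [h3]
  linear_combination 4 * this

variable {F : Type*} [Field F] [Fintype F] [DecidableEq F]

/-- The order of the cell of the image of a noncentral matrix, according to the roots of the
characteristic polynomial. -/
theorem exists_isCell_mk {p : ℕ} (hp : p.Prime) [CharP F p] {A : SL(2, F)}
    (hA : A ∉ Subgroup.center SL(2, F)) :
    ∃ T : Subgroup PSL(2, F), IsCell (A : PSL(2, F)) T ∧
      (((A 0 0 + A 1 1) ^ 2 = 4 ∧ Nat.card T = p) ∨
      (((A 0 0 + A 1 1) ^ 2 ≠ 4 ∧ ∃ a, a * (A 0 0 + A 1 1 - a) = 1) ∧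
        Nat.card T * Nat.gcd (Fintype.card F - 1) 2 = Fintype.card F - 1) ∨
      (((A 0 0 + A 1 1) ^ 2 ≠ 4 ∧ ∀ a, a * (A 0 0 + A 1 1 - a) ≠ 1) ∧
        Nat.card T * Nat.gcd (Fintype.card F - 1) 2 = Fintype.card F + 1)) := by
  rw [← card_center_SL_two]
  by_cases ht : (A 0 0 + A 1 1) ^ 2 = 4
  · obtain ⟨T, hT, hTp⟩ := isCell_of_trace_sq_eq_four hp hA ht
    exact ⟨T, hT, Or.inl ⟨ht, hTp⟩⟩
  · by_cases hs : ∃ a, a * (A 0 0 + A 1 1 - a) = 1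
    · obtain ⟨a, ha⟩ := hs
      obtain ⟨hc, hn⟩ := isCyclic_normOneUnits_of_split ht ha
      obtain ⟨T, hT, hTn⟩ := isCell_of_isCyclic hA hc
      exact ⟨T, hT, Or.inr (Or.inl ⟨⟨ht, a, ha⟩, by rw [hTn, hn, Nat.card_eq_fintype_card]⟩)⟩
    · have hs' : ∀ a, a * (A 0 0 + A 1 1 - a) ≠ 1 := fun a ha => hs ⟨a, ha⟩
      obtain ⟨hc, hn⟩ := isCyclic_normOneUnits_of_nonsplit hs'
      obtain ⟨T, hT, hTn⟩ := isCell_of_isCyclic hA hc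
      exact ⟨T, hT, Or.inr (Or.inr ⟨⟨ht, hs'⟩, by rw [hTn, hn, Nat.card_eq_fintype_card]⟩)⟩

theorem kappa_eq {p q k : ℕ} (hp : p.Prime) [CharP F p] (hq : Fintype.card F = q)
    (hpq : p ∣ q) (hq4 : 4 ≤ q) (hk : k = Nat.gcd (q - 1) 2) :
    kappa PSL(2, F) = p ^ ((q ^ 2 - 1) * (p - 2) / (p - 1))
      * kappaCyclic ((q - 1) / k) ^ (q * (q + 1) / 2)
      * kappaCyclic ((q + 1) / k) ^ (q * (q - 1) / 2) := by
  classical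
  have hk0 : 0 < k := hk ▸ Nat.gcd_pos_of_pos_right _ two_pos
  have hk2 : k ∣ 2 := hk ▸ Nat.gcd_dvd_right _ _
  have hkm : k ∣ q - 1 := hk ▸ Nat.gcd_dvd_left _ _
  have hkp : k ∣ q + 1 := by
    have := Nat.dvd_add hkm hk2
    rwa [show q - 1 + 2 = q + 1 by omega] at this
  have hkle : k ≤ 2 := Nat.le_of_dvd two_pos hk2
  obtain ⟨m, hm⟩ := hkm
  obtain ⟨l, hl⟩ := hkp
  rw [hm, hl, Nat.mul_div_cancel_left _ hk0, Nat.mul_div_cancel_left _ hk0]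
  -- The orders `p`, `m`, `l` are pairwise distinct, so the order of a cell determines the type of
  -- its trace.
  have hpm : p ≠ m := by
    rintro rfl
    have h1 : p ∣ q - 1 := ⟨k, by rw [hm, mul_comm]⟩
    have := (Nat.dvd_sub hpq h1)
    rw [show q - (q - 1) = 1 by omega] at this
    exact hp.one_lt.ne' (Nat.dvd_one.1 this)
  have hpl : p ≠ l := by
    rintro rfl
    have h1 : p ∣ q + 1 := ⟨k, by rw [hl, mul_comm]⟩
    have := (Nat.dvd_sub h1 hpq)
    rw [show q + 1 - q = 1 by omega] at this
    exact hp.one_lt.ne' (Nat.dvd_one.1 this)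
  have hml : m ≠ l := by
    rintro rfl
    omega
  -- This uses `q ≥ 4`. For `q = 2, 3` one would have `m = 1`, and the number `s` of split traces,
  -- cancelled below, would vanish.
  have hm1 : k < k * m := by omega
  have hl1 : k < k * l := by omega
  have hcell : ∀ g : PSL(2, F), g ≠ 1 → ∃ T, IsCell g T := by
    intro g hg
    obtain ⟨A, rfl⟩ := QuotientGroup.mk_surjective g
    obtain ⟨T, hT, -⟩ := exists_isCell_mk hp (mk_ne_one_iff.1 hg)
    exact ⟨T, hT⟩
  obtain ⟨𝒞, hκ, h𝒞, hcount⟩ := exists_partition_of_isCell hcell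
  have hmk : ∀ {A : SL(2, F)}, A ∉ Subgroup.center SL(2, F) →
      ∃ T : Subgroup PSL(2, F), IsCell (A : PSL(2, F)) T ∧
      (((A 0 0 + A 1 1) ^ 2 = 4 ∧ Nat.card T = p) ∨
      (((A 0 0 + A 1 1) ^ 2 ≠ 4 ∧ ∃ a, a * (A 0 0 + A 1 1 - a) = 1) ∧ Nat.card T = m) ∨
      (((A 0 0 + A 1 1) ^ 2 ≠ 4 ∧ ∀ a, a * (A 0 0 + A 1 1 - a) ≠ 1) ∧ Nat.card T = l)) := by
    intro A hA
    obtain ⟨T, hT, h⟩ := exists_isCell_mk hp hA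
    rw [hq, ← hk, hm, hl, mul_comm k m, mul_comm k l, Nat.mul_left_inj hk0.ne',
      Nat.mul_left_inj hk0.ne'] at h
    exact ⟨T, hT, h⟩
  have hcard : ∀ d, #(𝒞.filter fun C : Subgroup _ => Nat.card C = d) * (d - 1) * k =
      Nat.card {A : SL(2, F) // (A : PSL(2, F)) ≠ 1 ∧
        ∃ T, IsCell (A : PSL(2, F)) T ∧ Nat.card T = d} := by
    intro d
    rw [QuotientGroup.card_subtype_mk (Subgroup.center SL(2, F))
      fun g => g ≠ 1 ∧ ∃ T, IsCell g T ∧ Nat.card T = d, ← hcount, card_center_SL_two, hq, ← hk,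
      mul_comm]
  -- the number of cells of order `p`
  have hnp : #(𝒞.filter fun C : Subgroup _ => Nat.card C = p) * (p - 1) = q ^ 2 - 1 := by
    have h1 : ∀ A : SL(2, F), ((A : PSL(2, F)) ≠ 1 ∧
        ∃ T, IsCell (A : PSL(2, F)) T ∧ Nat.card T = p) ↔
        A ∈ ({A : SL(2, F) | (A 0 0 + A 1 1) ^ 2 = 4} : Finset SL(2, F)) \
          ({A : SL(2, F) | A ∈ Subgroup.center SL(2, F)} : Finset SL(2, F)) := by
      intro A
      rw [mem_sdiff, mem_filter, mem_filter, mk_ne_one_iff]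
      constructor
      · rintro ⟨hA, T, hT, hTp⟩
        refine ⟨⟨mem_univ _, ?_⟩, fun h => hA h.2⟩
        obtain ⟨S, hS, h | h | h⟩ := hmk hA
        · exact h.1
        · exact absurd (hTp.symm.trans ((hT.unique hS) ▸ h.2)) hpm
        · exact absurd (hTp.symm.trans ((hT.unique hS) ▸ h.2)) hpl
      · rintro ⟨⟨-, ht⟩, hA⟩
        have hA : A ∉ Subgroup.center SL(2, F) := fun h => hA ⟨mem_univ _, h⟩
        obtain ⟨S, hS, h | h | h⟩ := hmk hA
        · exact ⟨hA, S, hS, h.2⟩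
        · exact absurd ht h.1.1
        · exact absurd ht h.1.1
    have h2 := hcard p
    rw [Nat.card_congr (Equiv.subtypeEquivRight h1), Nat.card_eq_fintype_card, Fintype.card_coe,
      card_sdiff_of_subset (by
        intro A hA
        exact mem_filter.2 ⟨mem_univ _, trace_sq_eq_four_of_mem_center (mem_filter.1 hA).2⟩),
      card_trace_sq_eq_four, card_sq_eq_four, hq, ← hk, ← Fintype.card_subtype,
      ← Nat.card_eq_fintype_card] at h2
    have h3 : Nat.card {A // A ∈ Subgroup.center SL(2, F)} = k := by
      rw [hk, ← hq]; exact card_center_SL_two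
    rw [h3] at h2
    refine Nat.eq_of_mul_eq_mul_right hk0 ?_
    rw [h2, Nat.sub_mul, one_mul, mul_comm]
  -- the number of split cells
  have hsplit := two_mul_card_split_traces (F := F)
  rw [card_sq_eq_four, hq, ← hk] at hsplit
  have hnm : #(𝒞.filter fun C : Subgroup _ => Nat.card C = m) * 2 = q * (q + 1) := by
    have h1 : ∀ A : SL(2, F), ((A : PSL(2, F)) ≠ 1 ∧
        ∃ T, IsCell (A : PSL(2, F)) T ∧ Nat.card T = m) ↔
        A ∈ ({A : SL(2, F) | (A 0 0 + A 1 1) ^ 2 ≠ 4 ∧ ∃ a, a * (A 0 0 + A 1 1 - a) = 1} :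
          Finset SL(2, F)) := by
      intro A
      rw [mem_filter, mk_ne_one_iff]
      constructor
      · rintro ⟨hA, T, hT, hTp⟩
        refine ⟨mem_univ _, ?_⟩
        obtain ⟨S, hS, h | h | h⟩ := hmk hA
        · exact absurd (hTp.symm.trans ((hT.unique hS) ▸ h.2)) hpm.symm
        · exact h.1
        · exact absurd (hTp.symm.trans ((hT.unique hS) ▸ h.2)) hml
      · rintro ⟨-, ht⟩
        have hA : A ∉ Subgroup.center SL(2, F) :=
          fun h => ht.1 (trace_sq_eq_four_of_mem_center h)
        obtain ⟨S, hS, h | h | h⟩ := hmk hA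
        · exact absurd h.1 ht.1
        · exact ⟨hA, S, hS, h.2⟩
        · obtain ⟨a, ha⟩ := ht.2
          exact absurd ha (h.1.2 a)
    have h2 := hcard m
    rw [Nat.card_congr (Equiv.subtypeEquivRight h1), Nat.card_eq_fintype_card, Fintype.card_coe,
      card_split, hq] at h2
    set N := #(𝒞.filter fun C : Subgroup _ => Nat.card C = m)
    set s := #{t : F | t ^ 2 ≠ 4 ∧ ∃ a, a * (t - a) = 1}
    have h3 : (m - 1) * k = 2 * s := by
      rw [Nat.sub_mul, one_mul, mul_comm m k, ← hm]; omega
    have h4 : 0 < s := by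
      have : 0 < (m - 1) * k := by
        rw [Nat.sub_mul, one_mul, mul_comm m k]; omega
      omega
    refine Nat.eq_of_mul_eq_mul_right h4 ?_
    rw [mul_assoc, ← h3, ← mul_assoc, h2, mul_comm]
  -- the number of nonsplit cells
  have hnl : #(𝒞.filter fun C : Subgroup _ => Nat.card C = l) * 2 = q * (q - 1) := by
    have h1 : ∀ A : SL(2, F), ((A : PSL(2, F)) ≠ 1 ∧
        ∃ T, IsCell (A : PSL(2, F)) T ∧ Nat.card T = l) ↔
        A ∈ (univ : Finset SL(2, F)) \
          (({A : SL(2, F) | (A 0 0 + A 1 1) ^ 2 ≠ 4 ∧ ∃ a, a * (A 0 0 + A 1 1 - a) = 1} :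
            Finset SL(2, F)) ∪ ({A : SL(2, F) | (A 0 0 + A 1 1) ^ 2 = 4} : Finset SL(2, F))) := by
      intro A
      rw [mem_sdiff, mem_union, mem_filter, mem_filter, mk_ne_one_iff]
      constructor
      · rintro ⟨hA, T, hT, hTp⟩
        refine ⟨mem_univ _, ?_⟩
        obtain ⟨S, hS, h | h | h⟩ := hmk hA
        · exact absurd (hTp.symm.trans ((hT.unique hS) ▸ h.2)) hpl.symm
        · exact absurd (hTp.symm.trans ((hT.unique hS) ▸ h.2)) hml.symm
        · rintro (⟨-, -, a, ha⟩ | ⟨-, ht⟩)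
          · exact h.1.2 a ha
          · exact h.1.1 ht
      · rintro ⟨-, ht⟩
        have hA : A ∉ Subgroup.center SL(2, F) :=
          fun h => ht (Or.inr ⟨mem_univ _, trace_sq_eq_four_of_mem_center h⟩)
        obtain ⟨S, hS, h | h | h⟩ := hmk hA
        · exact absurd (Or.inr ⟨mem_univ _, h.1⟩) ht
        · exact absurd (Or.inl ⟨mem_univ _, h.1⟩) ht
        · exact ⟨hA, S, hS, h.2⟩
    have h2 := hcard l
    rw [Nat.card_congr (Equiv.subtypeEquivRight h1), Nat.card_eq_fintype_card, Fintype.card_coe,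
      card_sdiff_of_subset (subset_univ _), card_union_of_disjoint (by
        rw [disjoint_left]
        intro A h h'
        exact (mem_filter.1 h).2.1 (mem_filter.1 h').2), card_univ, card_SL_two,
      card_split, card_trace_sq_eq_four, card_sq_eq_four, hq, ← hk] at h2
    set N := #(𝒞.filter fun C : Subgroup _ => Nat.card C = l)
    set s := #{t : F | t ^ 2 ≠ 4 ∧ ∃ a, a * (t - a) = 1}
    -- Both sides are `q + 1 - k`, since `2 * s + k = q - 1`.
    have h3 : (l - 1) * k = 2 * (s + 1) := by
      rw [Nat.sub_mul, one_mul, mul_comm l k, ← hl]; omega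
    refine Nat.eq_of_mul_eq_mul_right (Nat.succ_pos s) ?_
    rw [mul_assoc, ← h3, ← mul_assoc, h2]
    obtain ⟨r, rfl⟩ : ∃ r, q = r + 1 := ⟨q - 1, by omega⟩
    simp only [Nat.add_sub_cancel] at hsplit ⊢
    subst hsplit
    simp only [Nat.succ_eq_add_one]
    refine Nat.sub_eq_of_eq_add ?_
    ring
  have hmaps : ∀ C ∈ 𝒞, Nat.card C ∈ ({p, m, l} : Finset ℕ) := by
    intro C hC
    obtain ⟨g, hg, hgC⟩ := h𝒞 C hC
    obtain ⟨A, rfl⟩ := QuotientGroup.mk_surjective g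
    obtain ⟨S, hS, h⟩ := hmk (mk_ne_one_iff.1 hg)
    rw [hgC.unique hS]
    simp only [mem_insert, mem_singleton]
    exact h.imp And.right (Or.imp And.right And.right)
  rw [hκ, ← prod_fiberwise_of_maps_to hmaps, prod_insert (by simp [hpm, hpl]),
    prod_insert (by simp [hml]), prod_singleton, ← mul_assoc]
  have hfib : ∀ d, ∏ C ∈ 𝒞.filter (fun C : Subgroup _ => Nat.card C = d), kappaCyclic (Nat.card C) =
      kappaCyclic d ^ #(𝒞.filter fun C : Subgroup _ => Nat.card C = d) := by
    intro d
    rw [prod_congr rfl (g := fun _ => kappaCyclic d), prod_const]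
    intro C hC
    rw [(mem_filter.1 hC).2]
  rw [← hm, ← hl, hfib, hfib, hfib, kappaCyclic_prime hp, ← pow_mul, ← hnp, ← hnm, ← hnl,
    Nat.mul_div_cancel _ two_pos, Nat.mul_div_cancel _ two_pos, mul_right_comm _ (p - 1),
    Nat.mul_div_cancel _ (Nat.sub_pos_of_lt hp.one_lt), mul_comm (p - 2), mul_right_comm _ (_ ^ _)]

end Matrix.ProjectiveSpecialLinearGroup

/-! ### A criterion for isomorphisms from `PSL(2, F)`. -/

section Correspondence

variable {G H : Type*} [Group G] [Group H]

/-- Two groups related by a subgroup `R` of their product which projects onto `G`. -/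
theorem nonempty_quotient_mulEquiv_of_subgroup_prod [Finite G] [Finite H] (N : Subgroup G)
    [N.Normal] (R : Subgroup (G × H)) (hR : ∀ g, ∃ h, (g, h) ∈ R) (hN : ∀ g, (g, 1) ∈ R → g ∈ N)
    (hcard : Nat.card H * Nat.card N ≤ Nat.card G) : Nonempty (G ⧸ N ≃* H) := by
  let p₁ : R →* G := (MonoidHom.fst G H).comp R.subtype
  let p₂ : R →* H := (MonoidHom.snd G H).comp R.subtype
  have h1 : Function.Surjective p₁ := fun g => by
    obtain ⟨h, hh⟩ := hR g
    exact ⟨⟨(g, h), hh⟩, rfl⟩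
  -- The kernel of the second projection embeds in `N`, so `R` has at most `card H * card N ≤ card
  -- G` elements. The first projection is then bijective, and `R` is the graph of a homomorphism.
  have hker : Nat.card p₂.ker ≤ Nat.card N := by
    refine Nat.card_le_card_of_injective (fun x : p₂.ker => (⟨p₁ x.1, hN _ ?_⟩ : N)) ?_
    · have h2 : x.1.1 = (p₁ x.1, 1) := Prod.ext rfl x.2
      rw [← h2]; exact x.1.2
    · intro x y hxy
      refine Subtype.ext (Subtype.ext (Prod.ext (congrArg Subtype.val hxy) ?_))
      exact (show x.1.1.2 = 1 from x.2).trans (show y.1.1.2 = 1 from y.2).symm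
  have hcR : Nat.card p₂.ker * Nat.card p₂.range = Nat.card R := by
    rw [← Subgroup.index_ker, Subgroup.card_mul_index]
  have hle : Nat.card R ≤ Nat.card G :=
    calc Nat.card R = Nat.card p₂.range * Nat.card p₂.ker := by rw [← hcR, mul_comm]
      _ ≤ Nat.card H * Nat.card N := Nat.mul_le_mul (Subgroup.card_le_card_group _) hker
      _ ≤ Nat.card G := hcard
  have hbij : Function.Bijective p₁ :=
    (Nat.bijective_iff_surjective_and_card p₁).2
      ⟨h1, le_antisymm hle (Nat.card_le_card_of_surjective p₁ h1)⟩
  let φ : G →* H := p₂.comp (MulEquiv.ofBijective p₁ hbij).symm.toMonoidHom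
  have hφ : ∀ g, (g, φ g) ∈ R := by
    intro g
    obtain ⟨r, rfl⟩ := hbij.2 g
    have : (MulEquiv.ofBijective p₁ hbij).symm (p₁ r) = r :=
      (MulEquiv.ofBijective p₁ hbij).symm_apply_apply r
    have h2 : φ (p₁ r) = p₂ r := congrArg p₂ this
    rw [h2]
    exact r.2
  have hφN : φ.ker ≤ N := fun g hg => hN g (by
    have := hφ g
    rwa [MonoidHom.mem_ker.1 hg] at this)
  have hφc : Nat.card φ.ker * Nat.card φ.range = Nat.card G := by
    rw [← Subgroup.index_ker, Subgroup.card_mul_index]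
  have hk : Nat.card φ.ker ≤ Nat.card N := Nat.card_mono (Set.toFinite _) hφN
  have hr : Nat.card φ.range ≤ Nat.card H := Subgroup.card_le_card_group _
  have hkpos : 0 < Nat.card N := Nat.card_pos
  have hrpos : 0 < Nat.card H := Nat.card_pos
  -- The kernel has order at most `card N` and the range at most `card H`; as the product of the
  -- orders is `card G ≥ card H * card N`, both bounds are attained.
  have hkeq : Nat.card φ.ker = Nat.card N := by
    refine le_antisymm hk (Nat.le_of_mul_le_mul_right ?_ hrpos)
    calc Nat.card N * Nat.card H ≤ Nat.card φ.ker * Nat.card φ.range := by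
          rw [hφc, mul_comm]; exact hcard
      _ ≤ Nat.card φ.ker * Nat.card H := Nat.mul_le_mul_left _ hr
  have hreq : Nat.card φ.range = Nat.card H := by
    refine le_antisymm hr (Nat.le_of_mul_le_mul_right ?_ hkpos)
    calc Nat.card H * Nat.card N ≤ Nat.card φ.ker * Nat.card φ.range := by rw [hφc]; exact hcard
      _ = Nat.card φ.range * Nat.card N := by rw [hkeq, mul_comm]
  have hN' : N = φ.ker := (Subgroup.eq_of_le_of_card_ge hφN hkeq.ge).symm
  have hsurj : Function.Surjective φ :=
    MonoidHom.range_eq_top.1 (Subgroup.eq_top_of_card_eq _ hreq)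
  exact ⟨(QuotientGroup.quotientMulEquivOfEq hN').trans
    (QuotientGroup.quotientKerEquivOfSurjective φ hsurj)⟩

/-- The pairs of group elements preserving a family of binary relations. -/
def relationStabilizer {X Y α : Type*} (ρ : G →* Equiv.Perm X) [MulAction H Y]
    (e : X → Y → Y → α) : Subgroup (G × H) where
  carrier := {p | ∀ x y z, e (ρ p.1 x) (p.2 • y) (p.2 • z) = e x y z}
  one_mem' := by intro x y z; simp
  mul_mem' := by
    intro p q hp hq x y z
    simp only [Prod.fst_mul, Prod.snd_mul, map_mul, Equiv.Perm.mul_apply, mul_smul]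
    rw [hp, hq]
  inv_mem' := by
    intro p hp x y z
    have := hp (ρ p.1⁻¹ x) (p.2⁻¹ • y) (p.2⁻¹ • z)
    rw [← Equiv.Perm.mul_apply, ← map_mul, mul_inv_cancel, map_one, smul_inv_smul,
      smul_inv_smul] at this
    exact this.symm

end Correspondence

namespace Matrix.SpecialLinearGroup

open OnePoint

variable {F : Type*} [Field F]

/-- The matrix of the map `x ↦ -1 / x`. -/
def weyl (F : Type*) [Field F] : SL(2, F) := finTwoMk 0 (-1) 1 0 (by ring)

theorem weyl_coe : (weyl F).1 = !![0, -1; 1, 0] := rfl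

theorem transvection_one_zero (c : F) : transvection (one_ne_zero : (1 : Fin 2) ≠ 0) c =
    weyl F * transvection (zero_ne_one : (0 : Fin 2) ≠ 1) (-c) * (weyl F)⁻¹ := by
  rw [eq_mul_inv_iff_mul_eq]
  ext i j
  rw [coe_mul, coe_mul, weyl_coe]
  fin_cases i <;> fin_cases j <;>
    simp [transvection_coe, Matrix.mul_apply, Matrix.single_apply]

/-- The upper transvections in `P` form an additive group, hence all of them occur; conjugating by
`weyl F` gives the lower ones, and transvections generate `SL(2, F)`. -/
theorem eq_top_of_transvection_mem_of_weyl_mem (P : Subgroup SL(2, F)) {S : Set F}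
    (hS : AddSubgroup.closure S = ⊤)
    (hu : ∀ b ∈ S, transvection (zero_ne_one : (0 : Fin 2) ≠ 1) b ∈ P) (hw : weyl F ∈ P) :
    P = ⊤ := by
  let U : AddSubgroup F :=
    { carrier := {b | transvection (zero_ne_one : (0 : Fin 2) ≠ 1) b ∈ P}
      zero_mem' := by
        change transvection _ 0 ∈ P
        rw [transvection_coeff_zero]; exact P.one_mem
      add_mem' := by
        intro a b ha hb
        change transvection _ (a + b) ∈ P
        rw [transvection_add]
        exact P.mul_mem ha hb
      neg_mem' := by
        intro a ha
        change transvection _ (-a) ∈ P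
        rw [← transvection_inv]
        exact P.inv_mem ha }
  have hU : ∀ b, transvection (zero_ne_one : (0 : Fin 2) ≠ 1) b ∈ P := by
    intro b
    have h1 : AddSubgroup.closure S ≤ U := (AddSubgroup.closure_le U).2 hu
    rw [hS] at h1
    exact h1 (AddSubgroup.mem_top b)
  refine (Subgroup.eq_top_iff' P).2 fun A => ?_
  refine SL2.transvection_induction (· ∈ P) ?_ (fun _ _ => P.mul_mem) A
  intro i j hij c
  match i, j, hij with
  | 0, 0, h => exact absurd rfl h
  | 1, 1, h => exact absurd rfl h
  | 0, 1, _ => exact hU c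
  | 1, 0, _ =>
    change transvection (one_ne_zero : (1 : Fin 2) ≠ 0) c ∈ P
    rw [transvection_one_zero]
    exact P.mul_mem (P.mul_mem hw (hU _)) (P.inv_mem hw)

variable [DecidableEq F]

/-- The action of `SL(2, F)` on the projective line. -/
def projectiveLineHom (F : Type*) [Field F] [DecidableEq F] :
    SL(2, F) →* Equiv.Perm (OnePoint F) :=
  (MulAction.toPermHom (GL (Fin 2) F) (OnePoint F)).comp toGL

theorem projectiveLineHom_infty (A : SL(2, F)) :
    projectiveLineHom F A ∞ = if A 1 0 = 0 then ∞ else ↑(A 0 0 / A 1 0) :=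
  smul_infty_eq_ite (toGL A)

theorem projectiveLineHom_coe (A : SL(2, F)) (x : F) : projectiveLineHom F A x =
    if A 1 0 * x + A 1 1 = 0 then ∞ else ↑((A 0 0 * x + A 0 1) / (A 1 0 * x + A 1 1)) :=
  smul_some_eq_ite (g := toGL A)

/-- Fixing `∞`, `0` and `1` already forces a scalar matrix. -/
theorem mem_center_of_projectiveLineHom_eq_one {A : SL(2, F)} (hA : projectiveLineHom F A = 1) :
    A ∈ Subgroup.center SL(2, F) := by
  have h0 := projectiveLineHom_infty A
  have h1 := projectiveLineHom_coe A 0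
  have h2 := projectiveLineHom_coe A 1
  rw [hA, Equiv.Perm.one_apply] at h0 h1 h2
  have hc : A 1 0 = 0 := by
    by_contra h
    rw [if_neg h] at h0
    exact infty_ne_coe _ h0
  have hdet := A.fin_two_det_eq_one
  rw [hc, mul_zero, sub_zero] at hdet
  have hd : A 1 1 ≠ 0 := right_ne_zero_of_mul_eq_one hdet
  simp only [hc, mul_zero, zero_add, if_neg hd, coe_eq_coe, mul_one] at h1 h2
  have hb : A 0 1 = 0 := by
    have := (div_eq_zero_iff.1 h1.symm).resolve_right hd
    exact this
  rw [hb, add_zero] at h2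
  exact fin_two_mem_center_iff.2 ⟨hb, hc, ((div_eq_one_iff_eq hd).1 h2.symm)⟩

theorem projectiveLineHom_transvection_infty (b : F) :
    projectiveLineHom F (transvection (zero_ne_one : (0 : Fin 2) ≠ 1) b) ∞ = ∞ := by
  rw [projectiveLineHom_infty]
  simp [transvection_coe]

theorem projectiveLineHom_transvection_coe (b x : F) :
    projectiveLineHom F (transvection (zero_ne_one : (0 : Fin 2) ≠ 1) b) x = ↑(x + b) := by
  rw [projectiveLineHom_coe]
  simp [transvection_coe]

theorem projectiveLineHom_weyl_infty : projectiveLineHom F (weyl F) ∞ = ↑(0 : F) := by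
  rw [projectiveLineHom_infty]
  simp [weyl, finTwoMk]

theorem projectiveLineHom_weyl_zero : projectiveLineHom F (weyl F) ↑(0 : F) = ∞ := by
  rw [projectiveLineHom_coe]
  simp [weyl, finTwoMk]

theorem projectiveLineHom_weyl_coe {x : F} (hx : x ≠ 0) :
    projectiveLineHom F (weyl F) x = ↑(-x⁻¹) := by
  rw [projectiveLineHom_coe]
  simp [weyl, finTwoMk, hx, neg_div]

end Matrix.SpecialLinearGroup

open OnePoint Matrix.SpecialLinearGroup in
/-- A criterion for `PSL(2, F) ≃* H`: the points of the projective line are separated by binary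
relations on an `H`-set, compatibly with the generators `x ↦ x + b` and `x ↦ -1 / x`. -/
theorem nonempty_PSL_two_mulEquiv {F H Y α : Type*} [Field F] [Fintype F] [DecidableEq F] [Group H]
    [Finite H] [MulAction H Y] (r₀ : Y → Y → α) (r : F → Y → Y → α)
    (hr₀ : ∀ x, r₀ ≠ r x) (hr : Function.Injective r)
    (hcard : Nat.card H * Nat.gcd (Fintype.card F - 1) 2 ≤
      Fintype.card F * (Fintype.card F - 1) * (Fintype.card F + 1))
    {S : Set F} (hS : AddSubgroup.closure S = ⊤)
    (hu : ∀ b ∈ S, ∃ h : H, (∀ y z, r₀ (h • y) (h • z) = r₀ y z) ∧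
      ∀ x y z, r (x + b) (h • y) (h • z) = r x y z)
    (hw : ∃ h : H, (∀ y z, r 0 (h • y) (h • z) = r₀ y z) ∧
      (∀ y z, r₀ (h • y) (h • z) = r 0 y z) ∧
      ∀ x x', x' * x = -1 → ∀ y z, r x' (h • y) (h • z) = r x y z) :
    Nonempty (PSL(2, F) ≃* H) := by
  let e : OnePoint F → Y → Y → α := fun x => x.elim r₀ r
  have he : Function.Injective e := by
    intro a b hab
    cases a with
    | infty =>
      cases b with
      | infty => rfl
      | coe b => exact absurd hab (hr₀ b)
    | coe a =>
      cases b with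
      | infty => exact absurd hab.symm (hr₀ a)
      | coe b => exact congrArg _ (hr hab)
  refine nonempty_quotient_mulEquiv_of_subgroup_prod _
    (relationStabilizer (projectiveLineHom F) e) ?_ ?_ ?_
  · have htop := eq_top_of_transvection_mem_of_weyl_mem
      ((relationStabilizer (projectiveLineHom F) e).map (MonoidHom.fst SL(2, F) H)) hS ?_ ?_
    · intro g
      have hg : g ∈ (⊤ : Subgroup SL(2, F)) := Subgroup.mem_top g
      rw [← htop] at hg
      obtain ⟨⟨g', h⟩, hgh, rfl⟩ := hg
      exact ⟨h, hgh⟩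
    · intro b hb
      obtain ⟨h, h1, h2⟩ := hu b hb
      refine ⟨(transvection zero_ne_one b, h), ?_, rfl⟩
      intro x y z
      cases x with
      | infty => rw [projectiveLineHom_transvection_infty]; exact h1 y z
      | coe x => rw [projectiveLineHom_transvection_coe]; exact h2 x y z
    · obtain ⟨h, h1, h2, h3⟩ := hw
      refine ⟨(weyl F, h), ?_, rfl⟩
      intro x y z
      cases x with
      | infty => rw [projectiveLineHom_weyl_infty]; exact h1 y z
      | coe x =>
        by_cases hx : x = 0
        · subst hx
          rw [projectiveLineHom_weyl_zero]; exact h2 y z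
        · rw [projectiveLineHom_weyl_coe hx]
          exact h3 x _ (by rw [neg_mul, inv_mul_cancel₀ hx]) y z
  · intro g hg
    refine mem_center_of_projectiveLineHom_eq_one (Equiv.ext fun x => he ?_)
    funext y z
    simpa using hg x y z
  · rw [card_center_SL_two, Nat.card_eq_fintype_card (α := SL(2, F)), card_SL_two]
    exact hcard

/-- Isomorphic fields have isomorphic projective special linear groups. -/
theorem nonempty_PSL_mulEquiv_of_ringEquiv {n : ℕ} {R S : Type*} [CommRing R] [CommRing S]
    (f : R ≃+* S) : Nonempty (PSL(n, R) ≃* PSL(n, S)) := by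
  let φ : SL(n, R) ≃* SL(n, S) := MonoidHom.toMulEquiv
    (Matrix.SpecialLinearGroup.map (f : R →+* S)) (Matrix.SpecialLinearGroup.map (f.symm : S →+* R))
    (by ext; simp) (by ext; simp)
  refine ⟨QuotientGroup.congr _ _ φ ?_⟩
  ext x
  rw [Subgroup.mem_map]
  constructor
  · rintro ⟨y, hy, rfl⟩
    exact (Subgroup.centerCongr φ ⟨y, hy⟩).2
  · intro hx
    exact ⟨φ.symm x, (Subgroup.centerCongr φ.symm ⟨x, hx⟩).2, φ.apply_symm_apply x⟩

/-! ### The exceptional isomorphisms. -/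

theorem ZMod.closure_one_eq_top (n : ℕ) [NeZero n] :
    AddSubgroup.closure ({1} : Set (ZMod n)) = ⊤ := by
  refine (AddSubgroup.eq_top_iff' _).2 fun x => ?_
  rw [AddSubgroup.mem_closure_singleton]
  exact ⟨x.val, by simp⟩

theorem QuadraticAlgebra.closure_one_omega_eq_top (n : ℕ) [NeZero n] (a b : ZMod n) :
    AddSubgroup.closure ({1, omega} : Set (QuadraticAlgebra (ZMod n) a b)) = ⊤ := by
  refine (AddSubgroup.eq_top_iff' _).2 fun x => ?_
  have h1 : x = x.re.val • 1 + x.im.val • omega := by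
    ext
    · rw [re_add, re_smul, re_smul, re_one, omega_re, smul_zero, add_zero, nsmul_eq_mul,
        ZMod.natCast_zmod_val, mul_one]
    · rw [im_add, im_smul, im_smul, im_one, omega_im, smul_zero, zero_add, nsmul_eq_mul,
        ZMod.natCast_zmod_val, mul_one]
  rw [h1]
  exact add_mem (nsmul_mem (AddSubgroup.subset_closure (by simp)) _)
    (nsmul_mem (AddSubgroup.subset_closure (by simp)) _)

instance QuadraticAlgebra.instFintype {R : Type*} [Fintype R] (a b : R) :
    Fintype (QuadraticAlgebra R a b) :=
  Fintype.ofEquiv _ (QuadraticAlgebra.equivProd a b).symm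

theorem QuadraticAlgebra.card_eq {R : Type*} [Fintype R] (a b : R) :
    Fintype.card (QuadraticAlgebra R a b) = Fintype.card R ^ 2 := by
  rw [Fintype.card_congr (QuadraticAlgebra.equivProd a b), Fintype.card_prod, sq]

theorem two_mul_card_alternatingGroup_fin (n : ℕ) [Nontrivial (Fin n)] :
    2 * Nat.card (alternatingGroup (Fin n)) = n.factorial := by
  rw [two_mul_nat_card_alternatingGroup, Nat.card_perm, Nat.card_fin]

/-- The product of two transpositions. -/
def swapMulSwap {n : ℕ} (a b c d : Fin n) (hab : a ≠ b) (hcd : c ≠ d) : alternatingGroup (Fin n) :=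
  ⟨Equiv.swap a b * Equiv.swap c d, by
    rw [Equiv.Perm.mem_alternatingGroup, Equiv.Perm.sign_mul, Equiv.Perm.sign_swap hab,
      Equiv.Perm.sign_swap hcd]; rfl⟩

instance Nat.fact_prime_five : Fact (Nat.Prime 5) := ⟨by norm_num⟩

instance Nat.fact_prime_seven : Fact (Nat.Prime 7) := ⟨by norm_num⟩

instance QuadraticAlgebra.fact_zmod_two : Fact (∀ r : ZMod 2, r ^ 2 ≠ 1 + 1 * r) := ⟨by decide⟩

instance QuadraticAlgebra.fact_zmod_three : Fact (∀ r : ZMod 3, r ^ 2 ≠ -1 + 0 * r) :=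
  ⟨by decide⟩

/-- The six points are labelled by one orbit of six pentagons on five vertices. The point `∞` is the
pentagon with steps 1 and 4; the point 0 is its image under `y ↦ 2 * y ^ 3`, which is the
permutation `(1 2)(3 4)`, and `x` is the translate by `x`. -/
theorem nonempty_PSL_two_five_mulEquiv :
    Nonempty (PSL(2, ZMod 5) ≃* alternatingGroup (Fin 5)) := by
  refine nonempty_PSL_two_mulEquiv (Y := Fin 5)
    (fun y z => decide (z - y = 1 ∨ z - y = 4))
    (fun (x : Fin 5) (y z : Fin 5) => decide (2 * (z - x) ^ 3 - 2 * (y - x) ^ 3 = 1 ∨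
      2 * (z - x) ^ 3 - 2 * (y - x) ^ 3 = 4))
    (fun x h => ?_) (fun x x' h => ?_) ?_ (ZMod.closure_one_eq_top 5) ?_ ?_
  · have key : ∀ x : Fin 5, ∃ y z : Fin 5, decide (z - y = 1 ∨ z - y = 4) ≠
      decide (2 * (z - x) ^ 3 - 2 * (y - x) ^ 3 = 1 ∨ 2 * (z - x) ^ 3 - 2 * (y - x) ^ 3 = 4) := by
      decide
    obtain ⟨y, z, hyz⟩ := key x
    exact hyz (congrFun (congrFun h y) z)
  · have key : ∀ x x' : Fin 5, (∀ y z : Fin 5,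
      decide (2 * (z - x) ^ 3 - 2 * (y - x) ^ 3 = 1 ∨ 2 * (z - x) ^ 3 - 2 * (y - x) ^ 3 = 4) =
      decide (2 * (z - x') ^ 3 - 2 * (y - x') ^ 3 = 1 ∨
        2 * (z - x') ^ 3 - 2 * (y - x') ^ 3 = 4)) → x = x' := by decide
    exact key x x' fun y z => congrFun (congrFun h y) z
  · have := two_mul_card_alternatingGroup_fin 5
    rw [ZMod.card]
    norm_num [Nat.factorial] at this ⊢
    omega
  · rintro _ rfl
    exact ⟨⟨finRotate 5, by rw [Equiv.Perm.mem_alternatingGroup, sign_finRotate]; rfl⟩,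
      by decide, by decide⟩
  · exact ⟨swapMulSwap 1 2 3 4 (by decide) (by decide), by decide, by decide, by decide⟩

/-- This is the action on the five points themselves: `a + b * omega` is numbered `a + 2 * b` and
`∞` is 4. The relations ignore their second argument. -/
theorem nonempty_PSL_two_four_mulEquiv :
    Nonempty (PSL(2, QuadraticAlgebra (ZMod 2) 1 1) ≃* alternatingGroup (Fin 5)) := by
  have hr : Function.Injective fun (x : QuadraticAlgebra (ZMod 2) 1 1) (y _z : Fin 5) =>
      decide (y.val = x.re.val + 2 * x.im.val) := by
    intro x x' h
    have key : ∀ x x' : QuadraticAlgebra (ZMod 2) 1 1, (∀ y : Fin 5,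
      decide (y.val = x.re.val + 2 * x.im.val) = decide (y.val = x'.re.val + 2 * x'.im.val)) →
      x = x' := by decide
    exact key x x' fun y => congrFun (congrFun h y) 0
  refine nonempty_PSL_two_mulEquiv (Y := Fin 5) (fun y _ => decide (y = 4)) _
    (fun x h => ?_) hr ?_ (QuadraticAlgebra.closure_one_omega_eq_top 2 1 1) ?_ ?_
  · have key : ∀ x : QuadraticAlgebra (ZMod 2) 1 1,
      decide ((4 : Fin 5) = 4) ≠ decide ((4 : Fin 5).val = x.re.val + 2 * x.im.val) := by decide
    exact key x (congrFun (congrFun h 4) 0)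
  · have := two_mul_card_alternatingGroup_fin 5
    rw [QuadraticAlgebra.card_eq, ZMod.card]
    norm_num [Nat.factorial] at this ⊢
    omega
  · rintro b (rfl | rfl)
    · exact ⟨swapMulSwap 0 1 2 3 (by decide) (by decide), by decide, by decide⟩
    · exact ⟨swapMulSwap 0 2 1 3 (by decide) (by decide), by decide, by decide⟩
  · exact ⟨swapMulSwap 0 4 2 3 (by decide) (by decide), by decide, by decide, by decide⟩

set_option maxRecDepth 10000 in
-- The ten points are labelled by the ten splittings of six objects into two triples: `∞` is `{0, 1,
-- 2}` against `{3, 4, 5}`, and `a + b * omega` exchanges `a` with `3 + b`. The relation is being in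
-- the same triple.
theorem nonempty_PSL_two_nine_mulEquiv :
    Nonempty (PSL(2, QuadraticAlgebra (ZMod 3) (-1) 0) ≃* alternatingGroup (Fin 6)) := by
  have hr : Function.Injective fun (x : QuadraticAlgebra (ZMod 3) (-1) 0) (y z : Fin 6) =>
      (xor (decide (y.val < 3)) (decide (y.val = x.re.val ∨ y.val = 3 + x.im.val)) ==
        xor (decide (z.val < 3)) (decide (z.val = x.re.val ∨ z.val = 3 + x.im.val))) := by
    intro x x' h
    have key : ∀ x x' : QuadraticAlgebra (ZMod 3) (-1) 0, (∀ y z : Fin 6,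
      (xor (decide (y.val < 3)) (decide (y.val = x.re.val ∨ y.val = 3 + x.im.val)) ==
        xor (decide (z.val < 3)) (decide (z.val = x.re.val ∨ z.val = 3 + x.im.val))) =
      (xor (decide (y.val < 3)) (decide (y.val = x'.re.val ∨ y.val = 3 + x'.im.val)) ==
        xor (decide (z.val < 3)) (decide (z.val = x'.re.val ∨ z.val = 3 + x'.im.val)))) →
      x = x' := by decide
    exact key x x' fun y z => congrFun (congrFun h y) z
  refine nonempty_PSL_two_mulEquiv (Y := Fin 6)
    (fun y z => decide (y.val < 3) == decide (z.val < 3)) _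
    (fun x h => ?_) hr ?_ (QuadraticAlgebra.closure_one_omega_eq_top 3 (-1) 0) ?_ ?_
  · have key : ∀ x : QuadraticAlgebra (ZMod 3) (-1) 0, ∃ y z : Fin 6,
      (decide (y.val < 3) == decide (z.val < 3)) ≠
      (xor (decide (y.val < 3)) (decide (y.val = x.re.val ∨ y.val = 3 + x.im.val)) ==
        xor (decide (z.val < 3)) (decide (z.val = x.re.val ∨ z.val = 3 + x.im.val))) := by decide
    obtain ⟨y, z, hyz⟩ := key x
    exact hyz (congrFun (congrFun h y) z)
  · have := two_mul_card_alternatingGroup_fin 6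
    rw [QuadraticAlgebra.card_eq, ZMod.card]
    norm_num [Nat.factorial] at this ⊢
    omega
  · rintro b (rfl | rfl)
    · exact ⟨swapMulSwap 0 1 1 2 (by decide) (by decide), by decide, by decide⟩
    · exact ⟨swapMulSwap 3 4 4 5 (by decide) (by decide), by decide, by decide⟩
  · exact ⟨swapMulSwap 0 3 1 2 (by decide) (by decide), by decide, by decide, by decide⟩

/-- A generator of the units of the field with eight elements, acting by multiplication. -/
def singerCycle : SL(3, ZMod 2) := ⟨!![0, 0, 1; 1, 0, 1; 0, 1, 0], by decide⟩

/-- The matrix exchanging the last two coordinates. -/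
def lastSwap : SL(3, ZMod 2) := ⟨!![1, 0, 0; 0, 0, 1; 0, 1, 0], by decide⟩

/-- The Paley tournament on the nonzero vectors, cyclically ordered by `singerCycle`. -/
def paleyTournament (y z : Fin 3 → ZMod 2) : Bool :=
  z = singerCycle • y ∨ z = singerCycle ^ 2 • y ∨ z = singerCycle ^ 4 • y

/-- The images of `paleyTournament` under the conjugates of `singerCycle`. -/
def conjTournament (x : Fin 7) (y z : Fin 3 → ZMod 2) : Bool :=
  -- `singerCycle` has order 7, so the exponent `7 - x.val` stands for `-x`.
  paleyTournament ((lastSwap * singerCycle ^ (7 - x.val)) • y)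
    ((lastSwap * singerCycle ^ (7 - x.val)) • z)

theorem card_SL_three_two_le : Nat.card SL(3, ZMod 2) ≤ 168 := by
  refine (Nat.card_le_card_of_injective _
    (Matrix.SpecialLinearGroup.toGL_injective (n := Fin 3) (R := ZMod 2))).trans ?_
  rw [Matrix.card_GL_field, ZMod.card]
  decide

set_option maxRecDepth 100000 in
-- The eight points are labelled by eight tournaments on the seven nonzero vectors. `singerCycle`
-- fixes the one at `∞` and rotates the others, while `lastSwap` plays the part of `x ↦ -1 / x`.
theorem nonempty_PSL_two_seven_mulEquiv : Nonempty (PSL(2, ZMod 7) ≃* SL(3, ZMod 2)) := by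
  refine nonempty_PSL_two_mulEquiv (Y := Fin 3 → ZMod 2) paleyTournament
    (fun x : ZMod 7 => conjTournament x)
    (fun x h => ?_) (fun x x' h => ?_) ?_ (ZMod.closure_one_eq_top 7) ?_ ?_
  · have key : ∀ x : Fin 7, ∃ y z, paleyTournament y z ≠ conjTournament x y z := by decide
    obtain ⟨y, z, hyz⟩ := key x
    exact hyz (congrFun (congrFun h y) z)
  · have key : ∀ x x' : Fin 7, (∀ y z, conjTournament x y z = conjTournament x' y z) →
      x = x' := by decide
    exact key x x' fun y z => congrFun (congrFun h y) z
  · rw [ZMod.card]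
    exact (Nat.mul_le_mul_right _ card_SL_three_two_le).trans (by decide)
  · rintro _ rfl
    have key : ∀ (x : Fin 7) (y z), conjTournament (x + 1) (singerCycle • y) (singerCycle • z) =
      conjTournament x y z := by decide
    exact ⟨singerCycle, by decide, key⟩
  · have key : ∀ x x' : Fin 7, x' * x = -1 → ∀ y z,
      conjTournament x' (lastSwap • y) (lastSwap • z) = conjTournament x y z := by decide
    exact ⟨lastSwap, by decide, by decide, key⟩

theorem Matrix.SpecialLinearGroup.center_three_zmod_two :
    Subgroup.center SL(3, ZMod 2) = ⊥ := by
  refine (Subgroup.eq_bot_iff_forall _).2 fun A hA => ?_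
  obtain ⟨r, hr, hA⟩ := Matrix.SpecialLinearGroup.mem_center_iff.1 hA
  have key : ∀ r : ZMod 2, r ^ 3 = 1 → r = 1 := by decide
  rw [Fintype.card_fin] at hr
  rw [key r hr] at hA
  exact Subtype.ext (by simpa using hA.symm)

theorem nonempty_PSL_three_two_mulEquiv : Nonempty (PSL(3, ZMod 2) ≃* PSL(2, ZMod 7)) := by
  obtain ⟨e⟩ := nonempty_PSL_two_seven_mulEquiv
  exact ⟨((QuotientGroup.quotientMulEquivOfEq
    Matrix.SpecialLinearGroup.center_three_zmod_two).trans QuotientGroup.quotientBot).trans e.symm⟩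

/-! ### Fields of given order and the final values. -/

theorem Matrix.ProjectiveSpecialLinearGroup.kappa_eq_of_card {F : Type*} [Field F] {p n q k : ℕ}
    (hp : p.Prime) (hn : 1 ≤ n) (h2 : (p, n) ≠ (2, 1)) (h3 : (p, n) ≠ (3, 1)) (hq : q = p ^ n)
    (hk : k = Nat.gcd (q - 1) 2) (hF : Nat.card F = q) :
    kappa PSL(2, F) =
      p ^ ((q ^ 2 - 1) * (p - 2) / (p - 1))
        * kappaCyclic ((q - 1) / k) ^ (q * (q + 1) / 2)
        * kappaCyclic ((q + 1) / k) ^ (q * (q - 1) / 2) := by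
  classical
  have : Finite F := Nat.finite_of_card_ne_zero
    (by rw [hF, hq]; exact pow_ne_zero _ hp.ne_zero)
  have := Fintype.ofFinite F
  have := Fact.mk hp
  have hF' : Fintype.card F = p ^ n := by rw [← Nat.card_eq_fintype_card, hF, hq]
  have : CharP F p := charP_of_card_eq_prime_pow hF'
  refine kappa_eq hp (hF'.trans hq.symm) (hq ▸ dvd_pow_self p (by omega)) ?_ hk
  subst hq
  have hp2 := hp.two_le
  rcases hn.eq_or_lt with rfl | hn
  · have : p ≠ 2 := by rintro rfl; exact h2 rfl
    have : p ≠ 3 := by rintro rfl; exact h3 rfl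
    rw [pow_one]
    omega
  · calc 4 = 2 ^ 2 := rfl
      _ ≤ p ^ 2 := Nat.pow_le_pow_left hp2 2
      _ ≤ p ^ n := Nat.pow_le_pow_right hp.pos hn

theorem nonempty_PSL_mulEquiv_of_card_eq {K L : Type*} [Field K] [Field L] [Finite K]
    [Finite L] (n : ℕ) (h : Nat.card K = Nat.card L) : Nonempty (PSL(n, K) ≃* PSL(n, L)) := by
  have := Fintype.ofFinite K
  have := Fintype.ofFinite L
  rw [Nat.card_eq_fintype_card, Nat.card_eq_fintype_card] at h
  exact nonempty_PSL_mulEquiv_of_ringEquiv (FiniteField.ringEquivOfCardEq h)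

theorem theorem5p1 :
    -- The general formula; `F` is any field with `q = p ^ n` elements.
    -- All subtractions and divisions of natural numbers here are exact.
    (∀ (p n q k : ℕ), p.Prime → 1 ≤ n → (p, n) ≠ (2, 1) → (p, n) ≠ (3, 1) →
      q = p ^ n → k = Nat.gcd (q - 1) 2 →
      ∀ (F : Type*) [Field F], Nat.card F = q →
        kappa PSL(2, F) =
          p ^ ((q ^ 2 - 1) * (p - 2) / (p - 1))
            * kappaCyclic ((q - 1) / k) ^ (q * (q + 1) / 2)
            * kappaCyclic ((q + 1) / k) ^ (q * (q - 1) / 2)) ∧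
    -- `A₅ ≅ L₂(5) ≅ L₂(4)` and its complexity
    (Nonempty (alternatingGroup (Fin 5) ≃* PSL(2, ZMod 5)) ∧
      Nonempty (PSL(2, ZMod 5) ≃* PSL(2, GaloisField 2 2)) ∧
      kappa (alternatingGroup (Fin 5)) = 3 ^ 10 * 5 ^ 18) ∧
    -- `L₃(2) ≅ L₂(7)` and its complexity
    (Nonempty (PSL(3, ZMod 2) ≃* PSL(2, ZMod 7)) ∧
      kappa PSL(3, ZMod 2) = 2 ^ 84 * 3 ^ 28 * 7 ^ 40) ∧
    -- `A₆ ≅ L₂(9)` and its complexity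
    (Nonempty (alternatingGroup (Fin 6) ≃* PSL(2, GaloisField 3 2)) ∧
      kappa (alternatingGroup (Fin 6)) = 2 ^ 180 * 3 ^ 40 * 5 ^ 108) := by
  obtain ⟨e5⟩ := nonempty_PSL_two_five_mulEquiv
  obtain ⟨e4⟩ := nonempty_PSL_two_four_mulEquiv
  obtain ⟨e9⟩ := nonempty_PSL_two_nine_mulEquiv
  obtain ⟨e7⟩ := nonempty_PSL_three_two_mulEquiv
  have c4 : Nat.card (QuadraticAlgebra (ZMod 2) 1 1) = 2 ^ 2 := by
    rw [Nat.card_eq_fintype_card, QuadraticAlgebra.card_eq, ZMod.card]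
  have c9 : Nat.card (QuadraticAlgebra (ZMod 3) (-1) 0) = 3 ^ 2 := by
    rw [Nat.card_eq_fintype_card, QuadraticAlgebra.card_eq, ZMod.card]
  obtain ⟨g4⟩ := nonempty_PSL_mulEquiv_of_card_eq 2
    (c4.trans (GaloisField.card 2 2 two_ne_zero).symm)
  obtain ⟨g9⟩ := nonempty_PSL_mulEquiv_of_card_eq 2
    (c9.trans (GaloisField.card 3 2 two_ne_zero).symm)
  have k2 : kappaCyclic 2 = 1 := by simpa using kappaCyclic_prime Nat.prime_two
  have k3 : kappaCyclic 3 = 3 := by simpa using kappaCyclic_prime Nat.prime_three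
  have k5 : kappaCyclic 5 = 5 ^ 3 := by simpa using kappaCyclic_prime Nat.prime_five
  refine ⟨fun p n q k hp hn h2 h3 hq hk F _ hF =>
      Matrix.ProjectiveSpecialLinearGroup.kappa_eq_of_card hp hn h2 h3 hq hk hF,
    ⟨⟨e5.symm⟩, ⟨(e5.trans e4.symm).trans g4⟩, ?_⟩, ⟨⟨e7⟩, ?_⟩, ⟨e9.symm.trans g9⟩, ?_⟩
  -- For `q = 5, 7, 9` the tori have orders 2 and 3, 3 and 4, 4 and 5, where `kappaCyclic` is known.
  · rw [← kappa_congr e5, Matrix.ProjectiveSpecialLinearGroup.kappa_eq_of_card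
      (p := 5) (n := 1) (q := 5) (k := 2) Nat.prime_five le_rfl (by decide) (by decide)
      (by norm_num) (by norm_num) (Nat.card_zmod 5)]
    norm_num [k2, k3]
  · rw [kappa_congr e7, Matrix.ProjectiveSpecialLinearGroup.kappa_eq_of_card
      (p := 7) (n := 1) (q := 7) (k := 2) (by norm_num) le_rfl (by decide) (by decide)
      (by norm_num) (by norm_num) (Nat.card_zmod 7)]
    norm_num [k3, kappaCyclic_four]
  · rw [← kappa_congr e9, Matrix.ProjectiveSpecialLinearGroup.kappa_eq_of_card
      (p := 3) (n := 2) (q := 9) (k := 2) Nat.prime_three (by norm_num) (by decide) (by decide)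
      (by norm_num) (by norm_num) c9]
    norm_num [k5, kappaCyclic_four]
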